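/- Let $\Omega=\{-1,1\}^{\mathbb Z^d}$, let $\sigma^i$ denote $\sigma$ with the spin at $i$ flipped, and for continuous $f:\Omega\to\mathbb R$ put $\delta_i f=\sup_\sigma (f(\sigma^i)-f(\sigma))$ and $\|\delta f\|_2^2=\sum_{i\in\mathbb Z^d}(\delta_i f)^2\in[0,\infty]$. A probability measure $\mu$ on $\Omega$ satisfies $\mathrm{GCB}(C)$, $C>0$, if $\int e^{f-\int f\,d\mu}\,d\mu\le e^{C\|\delta f\|_2^2}$ for all continuous $f$ with $\|\delta f\|_2<\infty$. A function is local if it depends on finitely many spins. Let $c(i,\cdot)$, $i\in\mathbb Z^d$, be continuous flip rates on $\Omega$ with $\inf_{i,\sigma}c(i,\sigma)>0$ and $\sup_i\sum_j\Gamma_{ij}<\infty$, where $\Gamma_{ij}=\sup_\sigma (c(i,\sigma^j)-c(i,\sigma))$. Let $(S(t))_{t\ge0}$ be the Feller semigroup on $C(\Omega)$ whose generator is the closure of $Lf(\sigma)=\sum_i c(i,\sigma)(f(\sigma^i)-f(\sigma))$, $f$ local. For a probability measure $\mu$, let $\mu S(t)$ be the probability measure with $\int f\,d\mu S(t)=\int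 S(t)f\,d\mu$ for all continuous $f$. **(0)** Let $t\ge 0$, suppose that $\delta_\sigma S(t)$ satisfies $\mathrm{GCB}(D_t)$ for every $\sigma\in\Omega$, with $D_t$ independent of $\sigma$, and that $\mu$ satisfies $\mathrm{GCB}(C_\mu)$. Then for every local $f$ both $\|\delta f\|_2$ and $\|\delta(S(t)f)\|_2$ are finite and $$\log\int e^{f-\int f\,d\mu S(t)}\,d\mu S(t)\le D_t\|\delta f\|_2^2+C_\mu\|\delta(S(t)f)\|_2^2 .$$ **(1)** Under the assumptions of (0), $\mu S(t)$ satisfies $\mathrm{GCB}(D_t+K(t)C_\mu)$ for every finite constant $K(t)\ge0$ such that $\|\delta(S(t)f)\|_2^2\le K(t)\|\delta f\|_2^2$ for all continuous $f$ with $\|\delta f\|_2<\infty$. If the matrix $\Gamma$ defines a bounded operator on $\ell^2(\mathbb Z^d)$, such a finite constant $K(t)$ exists for every $t\ge0$. **(2)** Suppose that $M<\varepsilon$ and $M^*<\varepsilon$, where $M=\sup_i\sum_{j\ne i}\Gamma_{ij}$, $M^*=\sup_j\sum_{i\ne j}\Gamma_{ij}$ (which equals $M$ if the rates are translation invariant)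 and $\varepsilon=\inf_{i,\sigma}\,(c(i,\sigma)+c(i,\sigma^i))$. Then there is $\alpha>0$, depending only on the dynamics, such that for all $t\ge 0$ and all $D_t,\mu,C_\mu$ as in (0), $\mu S(t)$ satisfies $\mathrm{GCB}(D_t+C_\mu e^{-\alpha t})$. Moreover there is exactly one stationary probability measure $\nu$, and if for every $t\ge0$ all the measures $\delta_\sigma S(t)$, $\sigma\in\Omega$, satisfy $\mathrm{GCB}(D_t)$, with $\sup_t D_t<\infty$, then $\nu$ satisfies $\mathrm{GCB}(\sup_{t} D_t)$. -/

import Mathlib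

open MeasureTheory Filter Topology
open scoped NNReal ENNReal

namespace SpinFlip

/-- The sites of the lattice `ℤ^d`. -/
abbrev Site (d : ℕ) : Type := Fin d → ℤ

/-- Ising spin configurations `Ω = {-1, 1}^{ℤ^d}` (`ℤˣ = {1, -1}`), with the product topology and
the product σ-field, which is its Borel σ-field. -/
abbrev Config (d : ℕ) : Type := Site d → ℤˣ

instance instBorelSpaceSpin : BorelSpace ℤˣ := by
  constructor
  rw [borel_eq_top_of_discrete]
  refine top_le_iff.1 fun s _ => ⟨(fun u : ℤˣ => (u : ℤ)) '' s, MeasurableSpace.measurableSet_top, ?_⟩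
  exact Set.preimage_image_eq s Units.val_injective

/-- The configuration `σ^i`, in which the spin at the site `i` is flipped. -/
def flip {d : ℕ} (i : Site d) (σ : Config d) : Config d := Function.update σ i (-σ i)

/-- `δ_i f = sup_σ (f(σ^i) - f(σ))`. The supremum is nonnegative, because exchanging `σ` and `σ^i`
changes the sign of the difference, so truncating the differences at `0` changes nothing. -/
noncomputable def delta {d : ℕ} (f : Config d → ℝ) (i : Site d) : ℝ≥0∞ :=
  ⨆ σ : Config d, ENNReal.ofReal (f (flip i σ) - f σ)

/-- `‖δf‖₂² = ∑_i (δ_i f)²`, possibly infinite. -/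
noncomputable def deltaNormSq {d : ℕ} (f : Config d → ℝ) : ℝ≥0∞ :=
  ∑' i : Site d, delta f i ^ 2

/-- The Gaussian concentration bound `GCB(C)`, `C > 0`: every continuous `f` satisfies
`E_μ(exp(f - E_μ f)) ≤ exp(C ‖δf‖₂²)`. (Nothing is claimed if `‖δf‖₂ = ∞`.) -/
def GCB {d : ℕ} (μ : ProbabilityMeasure (Config d)) (C : ℝ) : Prop :=
  0 < C ∧ ∀ f : C(Config d, ℝ), deltaNormSq f ≠ ⊤ →
    ∫ σ, Real.exp (f σ - ∫ ξ, f ξ ∂(μ : Measure (Config d))) ∂(μ : Measure (Config d))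
      ≤ Real.exp (C * (deltaNormSq f).toReal)

/-- A function is local if it depends on finitely many coordinates only. -/
def IsLocal {d : ℕ} (f : Config d → ℝ) : Prop :=
  ∃ Λ : Finset (Site d), DependsOn f (Λ : Set (Site d))

/-- `Γ_{ij} = sup_σ (c(i, σ^j) - c(i, σ))`. -/
noncomputable def Gam {d : ℕ} (c : Site d → C(Config d, ℝ)) (i j : Site d) : ℝ≥0∞ :=
  delta (c i) j

/-- The standing assumptions on the flip rates: strict positivity,
`inf_{i,σ} c(i,σ) > 0`, and locality, `sup_i ∑_j Γ_{ij} < ∞`. -/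
structure ConditionA {d : ℕ} (c : Site d → C(Config d, ℝ)) : Prop where
  pos : ∃ m : ℝ, 0 < m ∧ ∀ (i : Site d) (σ : Config d), m ≤ c i σ
  locality : ⨆ i : Site d, ∑' j : Site d, Gam c i j < ⊤

/-- A Markov (Feller) semigroup on `C(Ω)`: a strongly continuous semigroup of positive linear
operators that preserve the constant function `1`. -/
structure MarkovSemigroup (d : ℕ) where
  /-- The operators `S(t)`, `t ≥ 0`. -/
  op : ℝ≥0 → C(Config d, ℝ) →ₗ[ℝ] C(Config d, ℝ)
  op_zero : op 0 = LinearMap.id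
  op_add : ∀ s t : ℝ≥0, op (s + t) = op s ∘ₗ op t
  op_one : ∀ t : ℝ≥0, op t 1 = 1
  op_nonneg : ∀ (t : ℝ≥0) (f : C(Config d, ℝ)), 0 ≤ f → 0 ≤ op t f
  continuous_zero : ∀ f : C(Config d, ℝ), Tendsto (fun t : ℝ≥0 => op t f) (𝓝 0) (𝓝 f)

/-- The graph of the pregenerator `L f(σ) = ∑_i c(i,σ) (f(σ^i) - f(σ))` on local functions
(for a local `f` the sum has finitely many nonzero terms). -/
def pregeneratorGraph {d : ℕ} (c : Site d → C(Config d, ℝ)) :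
    Set (C(Config d, ℝ) × C(Config d, ℝ)) :=
  {p | IsLocal p.1 ∧ ∀ σ : Config d, p.2 σ = ∑' i : Site d, c i σ * (p.1 (flip i σ) - p.1 σ)}

namespace MarkovSemigroup

variable {d : ℕ} (S : MarkovSemigroup d)

/-- The graph of the infinitesimal generator of `S`: the pairs `(f, g)` for which
`(S(t) f - f) / t` converges to `g` uniformly as `t ↓ 0`. -/
def generatorGraph : Set (C(Config d, ℝ) × C(Config d, ℝ)) :=
  {p | Tendsto (fun t : ℝ≥0 => (t : ℝ)⁻¹ • (S.op t p.1 - p.1)) (𝓝[>] 0) (𝓝 p.2)}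

/-- `S` is the semigroup of the spin-flip dynamics with flip rates `c`: its generator is the
closure (in `C(Ω)` with the supremum norm) of the pregenerator `L` on local functions. -/
def IsGeneratedBy (c : Site d → C(Config d, ℝ)) : Prop :=
  S.generatorGraph = closure (pregeneratorGraph c)

/-- The positive linear functional `f ↦ ∫ S(t) f dμ`. -/
noncomputable def functional (t : ℝ≥0) (μ : ProbabilityMeasure (Config d)) :
    CompactlySupportedContinuousMap (Config d) ℝ →ₚ[ℝ] ℝ :=
  PositiveLinearMap.mk₀
    { toFun := fun f => ∫ σ, S.op t f.toContinuousMap σ ∂(μ : Measure (Config d))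
      map_add' := fun f g => by
        have h : (f + g).toContinuousMap = f.toContinuousMap + g.toContinuousMap := rfl
        rw [h, map_add]
        exact integral_add
          ((S.op t f.toContinuousMap).continuous.integrable_of_hasCompactSupport
            (HasCompactSupport.of_compactSpace _))
          ((S.op t g.toContinuousMap).continuous.integrable_of_hasCompactSupport
            (HasCompactSupport.of_compactSpace _))
      map_smul' := fun a f => by
        have h : (a • f).toContinuousMap = a • f.toContinuousMap := rfl
        rw [h, map_smul]
        exact integral_smul a _ }
    (fun f hf => integral_nonneg fun σ => S.op_nonneg t f.toContinuousMap (fun x => hf x) σ)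

/-- The time-evolved measure `μS(t)`, as a measure: the measure which represents
the functional `f ↦ ∫ S(t) f dμ`. -/
noncomputable def evolveMeasure (t : ℝ≥0) (μ : ProbabilityMeasure (Config d)) :
    Measure (Config d) :=
  RealRMK.rieszMeasure (S.functional t μ)

theorem integral_evolveMeasure (t : ℝ≥0) (μ : ProbabilityMeasure (Config d))
    (f : C(Config d, ℝ)) :
    ∫ σ, f σ ∂(S.evolveMeasure t μ) = ∫ σ, S.op t f σ ∂(μ : Measure (Config d)) :=
  RealRMK.integral_rieszMeasure (S.functional t μ)
    (CompactlySupportedContinuousMap.continuousMapEquiv f)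

theorem isProbabilityMeasure_evolveMeasure (t : ℝ≥0) (μ : ProbabilityMeasure (Config d)) :
    IsProbabilityMeasure (S.evolveMeasure t μ) := by
  have h := S.integral_evolveMeasure t μ 1
  rw [S.op_one] at h
  simp only [ContinuousMap.one_apply, integral_const, smul_eq_mul, mul_one,
    probReal_univ] at h
  refine ⟨?_⟩
  rw [Measure.real, ENNReal.toReal_eq_one_iff] at h
  exact h

/-- The time-evolved measure `μS(t)`, determined by `∫ f dμS(t) = ∫ S(t) f dμ`. -/
noncomputable def evolve (t : ℝ≥0) (μ : ProbabilityMeasure (Config d)) :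
    ProbabilityMeasure (Config d) :=
  ⟨S.evolveMeasure t μ, S.isProbabilityMeasure_evolveMeasure t μ⟩

theorem integral_evolve (t : ℝ≥0) (μ : ProbabilityMeasure (Config d)) (f : C(Config d, ℝ)) :
    ∫ σ, f σ ∂(S.evolve t μ : Measure (Config d))
      = ∫ σ, S.op t f σ ∂(μ : Measure (Config d)) :=
  S.integral_evolveMeasure t μ f

/-- `ν` is a stationary measure: `νS(t) = ν` for all `t ≥ 0`. -/
def IsStationary (ν : ProbabilityMeasure (Config d)) : Prop :=
  ∀ t : ℝ≥0, S.evolve t ν = ν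

/-- All the measures `δ_σ S(t)`, `σ ∈ Ω`, satisfy `GCB(D)`, with the same constant `D`. -/
def DiracGCB (t : ℝ≥0) (D : ℝ) : Prop :=
  ∀ σ : Config d, GCB (S.evolve t (diracProba σ)) D

/-- `K` is an admissible time-dependent constant `K(t)`: `‖δ(S(t)f)‖₂² ≤ K ‖δf‖₂²` for all
continuous `f` with `‖δf‖₂ < ∞`. -/
def DeltaBound (t : ℝ≥0) (K : ℝ≥0) : Prop :=
  ∀ f : C(Config d, ℝ), deltaNormSq f ≠ ⊤ →
    deltaNormSq (S.op t f) ≤ (K : ℝ≥0∞) * deltaNormSq f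

end MarkovSemigroup

/-- The nonnegative matrix `Γ` is a bounded operator on `ℓ²(ℤ^d)`. -/
def GamBoundedL2 {d : ℕ} (c : Site d → C(Config d, ℝ)) : Prop :=
  ∃ B : ℝ≥0, ∀ a : Site d → ℝ≥0∞,
    ∑' i : Site d, (∑' j : Site d, Gam c i j * a j) ^ 2 ≤ (B : ℝ≥0∞) * ∑' i : Site d, a i ^ 2

/-- `M = sup_i ∑_{j ≠ i} Γ_{ij}`. -/
noncomputable def rowM {d : ℕ} (c : Site d → C(Config d, ℝ)) : ℝ≥0∞ :=
  ⨆ i : Site d, ∑' j : {j : Site d // j ≠ i}, Gam c i j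

/-- `M* = sup_j ∑_{i ≠ j} Γ_{ij}`; equal to `M` if the rates are translation invariant. -/
noncomputable def colM {d : ℕ} (c : Site d → C(Config d, ℝ)) : ℝ≥0∞ :=
  ⨆ j : Site d, ∑' i : {i : Site d // i ≠ j}, Gam c i j

/-- `ε = inf_{i,σ} (c(i,σ) + c(i,σ^i))`. -/
noncomputable def rateEps {d : ℕ} (c : Site d → C(Config d, ℝ)) : ℝ≥0∞ :=
  ⨅ (i : Site d) (σ : Config d), ENNReal.ofReal (c i σ + c i (flip i σ))

end SpinFlip

namespace SpinFlip

variable {d : ℕ}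

/-! ### Flips, freezing and oscillations -/

/-! Integrating `exp f` against `μS(t)` is integrating `S(t) exp f` against `μ`. Concentration of
`δ_σ S(t)` bounds `S(t) exp f` at `σ` by `exp (S(t) f σ + D ‖δf‖²)`, and concentration of `μ`,
applied to `S(t) f`, finishes (`DiracGCB.integral_exp_evolve_le`). What remains is to control
`δ(S(t) f)`.

For an Euler step `1 + hL`, `δ_x` becomes at most `(1 - hε) δ_x f + h ∑_{u ≠ x} Γ_{ux} δ_u f`
(`delta_eulerStep_le`). Hence, in a norm where the transposed off-diagonal part of `Γ` has bound
`b`, oscillations grow at most like `exp (t (b - ε))` (`IsGeneratedBy.norm_delta_op_le`). In `ℓ¹`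
one may take `b = M`: this gives finiteness for local `f` and, if `M < ε`, loss of memory, hence a
unique stationary measure. In `ℓ²`, `b` comes from boundedness of `Γ` or from Schur's test, and
gives `K(t)`.

The generator is known only on local functions, so the steps are taken in a finite box with frozen
rates. They converge to `S(t)` (`IsGeneratedBy.exists_eulerStep_approx`), and lower semicontinuity
of oscillations carries the bounds to the limit. -/

theorem continuous_flip (i : Site d) : Continuous (flip (d := d) i) :=
  continuous_id.update i (continuous_of_discreteTopology.comp (continuous_apply i))

@[simp] theorem flip_flip (i : Site d) (σ : Config d) : flip i (flip i σ) = σ := by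
  ext j; by_cases h : j = i
  · subst h; simp [flip]
  · simp [flip, h]

theorem flip_comm (i j : Site d) (σ : Config d) : flip i (flip j σ) = flip j (flip i σ) := by
  by_cases h : i = j
  · rw [h]
  · ext k; simp only [flip, Function.update_apply]; split_ifs <;> simp_all

/-- The flip at a site, as a continuous map. -/
def flipMap (i : Site d) : C(Config d, Config d) := ⟨flip i, continuous_flip i⟩

@[simp] theorem flipMap_apply (i : Site d) (σ : Config d) : flipMap i σ = flip i σ := rfl

theorem ofReal_sub_le_delta (f : Config d → ℝ) (i : Site d) (σ : Config d) :
    ENNReal.ofReal (f (flip i σ) - f σ) ≤ delta f i :=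
  le_iSup (fun σ => ENNReal.ofReal (f (flip i σ) - f σ)) σ

theorem delta_le {f : Config d → ℝ} {i : Site d} {r : ℝ≥0∞}
    (h : ∀ σ, ENNReal.ofReal (f (flip i σ) - f σ) ≤ r) : delta f i ≤ r :=
  iSup_le h

theorem ofReal_abs_sub_le_delta (f : Config d → ℝ) (i : Site d) (σ : Config d) :
    ENNReal.ofReal |f (flip i σ) - f σ| ≤ delta f i := by
  rcases abs_cases (f (flip i σ) - f σ) with ⟨h, -⟩ | ⟨h, -⟩ <;> rw [h]
  · exact ofReal_sub_le_delta f i σ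
  · have := ofReal_sub_le_delta f i (flip i σ)
    rwa [flip_flip, ← neg_sub] at this

theorem delta_ne_top (f : C(Config d, ℝ)) (i : Site d) : delta f i ≠ ⊤ := by
  refine ne_top_of_le_ne_top (b := ENNReal.ofReal (2 * ‖f‖)) ENNReal.ofReal_ne_top
    (delta_le fun σ => ENNReal.ofReal_le_ofReal ?_)
  have h1 := f.norm_coe_le_norm (flip i σ)
  have h2 := f.norm_coe_le_norm σ
  rw [Real.norm_eq_abs, abs_le] at h1 h2
  linarith

theorem abs_sub_le_delta_toReal (f : C(Config d, ℝ)) (i : Site d) (σ : Config d) :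
    |f (flip i σ) - f σ| ≤ (delta f i).toReal :=
  (ENNReal.ofReal_le_iff_le_toReal (delta_ne_top f i)).1 (ofReal_abs_sub_le_delta f i σ)

theorem flip_of_ne {i j : Site d} (h : j ≠ i) (σ : Config d) : flip i σ j = σ j := by
  simp [flip, h]

theorem apply_flip_of_dependsOn {f : Config d → ℝ} {B : Finset (Site d)}
    (hf : DependsOn f (B : Set (Site d))) {i : Site d} (hi : i ∉ B) (σ : Config d) :
    f (flip i σ) = f σ :=
  hf fun j hj => flip_of_ne (fun h => hi (by rw [← h]; exact hj)) σ

theorem delta_eq_zero {f : Config d → ℝ} {B : Finset (Site d)}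
    (hf : DependsOn f (B : Set (Site d))) {i : Site d} (hi : i ∉ B) : delta f i = 0 :=
  le_antisymm (delta_le fun σ => by rw [apply_flip_of_dependsOn hf hi]; simp) bot_le

theorem update_eq_or_flip (σ : Config d) (j : Site d) (u : ℤˣ) :
    Function.update σ j u = σ ∧ u = σ j ∨ Function.update σ j u = flip j σ ∧ u ≠ σ j := by
  by_cases h : u = σ j
  · left; subst h; simp
  · right
    refine ⟨?_, h⟩
    rw [flip]; congr
    rcases Int.units_eq_one_or u with h1 | h1 <;>
      rcases Int.units_eq_one_or (σ j) with h2 | h2 <;> simp_all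

open Classical in
-- Telescoping: the spins in `Λ` are changed one at a time, and only a site of disagreement costs
-- anything.
theorem ofReal_abs_sub_piecewise_le (f : Config d → ℝ) (σ ξ : Config d) (Λ : Finset (Site d)) :
    ENNReal.ofReal |f (Λ.piecewise σ ξ) - f ξ|
      ≤ ∑ j ∈ Λ, if σ j ≠ ξ j then delta f j else 0 := by
  induction Λ using Finset.induction_on with
  | empty => simp
  | insert j s hj ih =>
    rw [Finset.piecewise_insert, Finset.sum_insert hj]
    set ζ := s.piecewise σ ξ with hζ
    have hζj : ζ j = ξ j := by simp [hζ, hj]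
    rcases update_eq_or_flip ζ j (σ j) with ⟨h1, h2⟩ | ⟨h1, h2⟩
    · rw [h1]; exact ih.trans (le_add_of_nonneg_left bot_le)
    · rw [h1, if_pos (by rwa [hζj] at h2)]
      calc ENNReal.ofReal |f (flip j ζ) - f ξ|
          ≤ ENNReal.ofReal (|f (flip j ζ) - f ζ| + |f ζ - f ξ|) :=
            ENNReal.ofReal_le_ofReal (abs_sub_le _ _ _)
        _ = ENNReal.ofReal |f (flip j ζ) - f ζ| + ENNReal.ofReal |f ζ - f ξ| :=
            ENNReal.ofReal_add (abs_nonneg _) (abs_nonneg _)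
        _ ≤ _ := add_le_add (ofReal_abs_sub_le_delta f j ζ) ih

open Classical in
/-- The oscillation of a continuous function between two configurations is at most the sum of its
oscillations at the sites where they differ. -/
theorem ofReal_abs_sub_le_tsum (f : C(Config d, ℝ)) (σ ξ : Config d) :
    ENNReal.ofReal |f σ - f ξ| ≤ ∑' j, if σ j ≠ ξ j then delta f j else 0 := by
  have h1 : Tendsto (fun Λ : Finset (Site d) => Λ.piecewise σ ξ) atTop (𝓝 σ) := by
    rw [tendsto_pi_nhds]
    intro j
    refine tendsto_const_nhds.congr' ?_
    filter_upwards [eventually_ge_atTop {j}] with Λ hΛ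
    rw [Finset.piecewise_eq_of_mem]
    exact hΛ (Finset.mem_singleton_self j)
  have h2 : Tendsto (fun Λ : Finset (Site d) => ENNReal.ofReal |f (Λ.piecewise σ ξ) - f ξ|) atTop
      (𝓝 (ENNReal.ofReal |f σ - f ξ|)) :=
    ENNReal.tendsto_ofReal ((((f.continuous.tendsto σ).comp h1).sub tendsto_const_nhds).abs)
  exact le_of_tendsto h2 (Eventually.of_forall fun Λ =>
    (ofReal_abs_sub_piecewise_le f σ ξ Λ).trans (ENNReal.sum_le_tsum _))

theorem ofReal_abs_sub_le_tsum_delta (f : C(Config d, ℝ)) (σ ξ : Config d) :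
    ENNReal.ofReal |f σ - f ξ| ≤ ∑' j, delta f j := by
  classical
  exact (ofReal_abs_sub_le_tsum f σ ξ).trans
    (ENNReal.tsum_le_tsum fun j => by split_ifs <;> simp)

open Classical in
/-- Setting the spins outside `B` to `1`. -/
noncomputable def freeze (B : Finset (Site d)) : C(Config d, Config d) :=
  ⟨fun σ i => if i ∈ B then σ i else 1, continuous_pi fun i => by
    split_ifs
    · exact continuous_apply i
    · exact continuous_const⟩

theorem freeze_of_mem {B : Finset (Site d)} {i : Site d} (hi : i ∈ B) (σ : Config d) :
    freeze B σ i = σ i := by simp [freeze, hi]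

theorem freeze_flip_of_mem {B : Finset (Site d)} {i : Site d} (hi : i ∈ B) (σ : Config d) :
    freeze B (flip i σ) = flip i (freeze B σ) := by
  funext j
  by_cases hj : j = i
  · subst hj; simp [freeze, flip, hi]
  · by_cases hjB : j ∈ B <;> simp [freeze, flip, hj, hjB]

theorem freeze_congr {B : Finset (Site d)} {σ ξ : Config d}
    (h : ∀ i ∈ (B : Set (Site d)), σ i = ξ i) : freeze B σ = freeze B ξ := by
  funext j
  by_cases hj : j ∈ B
  · simpa [freeze, hj] using h j hj
  · simp [freeze, hj]

theorem dependsOn_comp_freeze {α : Type*} (f : Config d → α) (B : Finset (Site d)) :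
    DependsOn (fun σ => f (freeze B σ)) (B : Set (Site d)) :=
  fun _ _ h => congrArg f (freeze_congr h)

theorem delta_comp_freeze_le (f : C(Config d, ℝ)) (B : Finset (Site d)) (i : Site d) :
    delta (f.comp (freeze B)) i ≤ delta f i := by
  by_cases hi : i ∈ B
  · refine delta_le fun σ => ?_
    simp only [ContinuousMap.comp_apply, freeze_flip_of_mem hi]
    exact ofReal_sub_le_delta f i _
  · exact (delta_eq_zero (dependsOn_comp_freeze f B) hi).trans_le bot_le

/-- Gives density of the local functions, by approximants that do not increase any oscillation. By
compactness, local uniform convergence suffices, and `freeze B ξ` tends to `σ` jointly as `B` grows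
and `ξ` tends to `σ`. -/
theorem tendsto_comp_freeze (f : C(Config d, ℝ)) :
    Tendsto (fun B => f.comp (freeze B)) atTop (𝓝 f) := by
  rw [ContinuousMap.tendsto_iff_tendstoUniformly,
    ← tendstoLocallyUniformly_iff_tendstoUniformly_of_compactSpace,
    tendstoLocallyUniformly_iff_forall_tendsto]
  intro σ
  have h1 : Tendsto (fun p : Finset (Site d) × Config d => p.2) (atTop ×ˢ 𝓝 σ) (𝓝 σ) :=
    tendsto_snd
  have h2 : Tendsto (fun p : Finset (Site d) × Config d => freeze p.1 p.2) (atTop ×ˢ 𝓝 σ)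
      (𝓝 σ) := by
    rw [tendsto_pi_nhds]
    intro j
    have h3 : Tendsto (fun p : Finset (Site d) × Config d => p.2 j) (atTop ×ˢ 𝓝 σ) (𝓝 (σ j)) :=
      ((continuous_apply j).tendsto σ).comp h1
    refine h3.congr' ?_
    filter_upwards [tendsto_fst.eventually (eventually_ge_atTop ({j} : Finset (Site d)))] with p hp
    exact (freeze_of_mem (hp (Finset.mem_singleton_self j)) _).symm
  have h4 := ((f.continuous.tendsto σ).comp h1).prodMk_nhds ((f.continuous.tendsto σ).comp h2)
  exact h4.mono_right (nhds_le_uniformity _)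

/-! ### Lower semicontinuity of the oscillations -/

/-- A supremum of continuous functions of `f`. Upper bounds on oscillations therefore survive
uniform limits. -/
theorem lowerSemicontinuous_delta (i : Site d) :
    LowerSemicontinuous fun f : C(Config d, ℝ) => delta f i := by
  refine lowerSemicontinuous_iSup fun σ => Continuous.lowerSemicontinuous ?_
  exact ENNReal.continuous_ofReal.comp
    ((continuous_eval_const _).sub (continuous_eval_const _))

theorem isClosed_deltaNormSq_le (r : ℝ≥0∞) :
    IsClosed {f : C(Config d, ℝ) | deltaNormSq f ≤ r} := by
  have h : LowerSemicontinuous fun f : C(Config d, ℝ) => deltaNormSq f :=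
    lowerSemicontinuous_tsum fun i => (ENNReal.continuous_pow 2).comp_lowerSemicontinuous
      (lowerSemicontinuous_delta i) (fun a b hab => by dsimp only; gcongr)
  exact h.isClosed_preimage r

theorem isClosed_tsum_delta_le (r : ℝ≥0∞) :
    IsClosed {f : C(Config d, ℝ) | ∑' i, delta f i ≤ r} := by
  have h : LowerSemicontinuous fun f : C(Config d, ℝ) => ∑' i, delta f i :=
    lowerSemicontinuous_tsum fun i => lowerSemicontinuous_delta i
  exact h.isClosed_preimage r

theorem tsum_delta_ne_top {f : C(Config d, ℝ)} (hf : IsLocal f) : ∑' i, delta f i ≠ ⊤ := by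
  obtain ⟨B, hB⟩ := hf
  rw [tsum_eq_sum (s := B) fun i hi => delta_eq_zero hB hi]
  exact ENNReal.sum_ne_top.2 fun i _ => delta_ne_top f i

theorem tsum_sq_le_sq_tsum {ι : Type*} (a : ι → ℝ≥0∞) : ∑' i, a i ^ 2 ≤ (∑' i, a i) ^ 2 := by
  rw [sq, ← ENNReal.tsum_mul_right]
  exact ENNReal.tsum_le_tsum fun i => by rw [sq]; gcongr; exact ENNReal.le_tsum i

theorem tsum_sq_ne_top {ι : Type*} {a : ι → ℝ≥0∞} (h : ∑' i, a i ≠ ⊤) : ∑' i, a i ^ 2 ≠ ⊤ :=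
  ne_top_of_le_ne_top (ENNReal.pow_ne_top h) (tsum_sq_le_sq_tsum a)

/-! ### `ℓ²` inequalities for extended nonnegative sequences -/

theorem tsum_mul_sq_le {ι : Type*} (f g : ι → ℝ≥0∞) :
    (∑' i, f i * g i) ^ 2 ≤ (∑' i, f i ^ 2) * ∑' i, g i ^ 2 := by
  let _ : MeasurableSpace ι := ⊤
  have h := ENNReal.lintegral_mul_le_Lp_mul_Lq (μ := (Measure.count : Measure ι))
    (f := f) (g := g) Real.HolderConjugate.two_two measurable_from_top.aemeasurable
    measurable_from_top.aemeasurable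
  simp only [lintegral_count, Pi.mul_apply, ENNReal.rpow_two] at h
  calc (∑' i, f i * g i) ^ 2
      ≤ ((∑' i, f i ^ 2) ^ (1 / 2 : ℝ) * (∑' i, g i ^ 2) ^ (1 / 2 : ℝ)) ^ 2 := by gcongr
    _ = _ := by
      rw [mul_pow, ← ENNReal.rpow_two, ← ENNReal.rpow_two, ← ENNReal.rpow_mul, ← ENNReal.rpow_mul]
      norm_num

theorem tsum_add_sq_rpow_le {ι : Type*} (f g : ι → ℝ≥0∞) :
    (∑' i, (f i + g i) ^ 2) ^ (1 / 2 : ℝ)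
      ≤ (∑' i, f i ^ 2) ^ (1 / 2 : ℝ) + (∑' i, g i ^ 2) ^ (1 / 2 : ℝ) := by
  let _ : MeasurableSpace ι := ⊤
  have h := ENNReal.lintegral_Lp_add_le (μ := (Measure.count : Measure ι))
    (f := f) (g := g) measurable_from_top.aemeasurable measurable_from_top.aemeasurable
    (p := 2) (by norm_num)
  simpa only [lintegral_count, Pi.add_apply, ENNReal.rpow_two] using h

/-! ### The influence operator -/

/-- The off-diagonal part of `Γ`. -/
noncomputable def offDiag (c : Site d → C(Config d, ℝ)) (i j : Site d) : ℝ≥0∞ :=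
  if j = i then 0 else Gam c i j

/-- The transpose of the off-diagonal part of `Γ`, acting on sequences. -/
noncomputable def influence (c : Site d → C(Config d, ℝ)) (a : Site d → ℝ≥0∞) (j : Site d) :
    ℝ≥0∞ :=
  ∑' i, offDiag c i j * a i

section

variable (c : Site d → C(Config d, ℝ))

theorem offDiag_le (i j : Site d) : offDiag c i j ≤ Gam c i j := by
  unfold offDiag; split_ifs <;> simp

theorem tsum_offDiag_row (i : Site d) : ∑' j, offDiag c i j ≤ rowM c := by
  refine le_trans (le_of_eq ?_) (le_iSup (fun i => ∑' j : {j : Site d // j ≠ i}, Gam c i j) i)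
  refine Eq.trans ?_ (tsum_subtype {j | j ≠ i} (Gam c i)).symm
  congr 1; ext j
  by_cases h : j = i <;> simp [offDiag, h]

theorem tsum_offDiag_col (j : Site d) : ∑' i, offDiag c i j ≤ colM c := by
  refine le_trans (le_of_eq ?_) (le_iSup (fun j => ∑' i : {i : Site d // i ≠ j}, Gam c i j) j)
  refine Eq.trans ?_ (tsum_subtype {i | i ≠ j} fun i => Gam c i j).symm
  congr 1; ext i
  by_cases h : i = j
  · simp [offDiag, h]
  · simp [offDiag, h, Ne.symm h]

theorem rowM_lt_top {c : Site d → C(Config d, ℝ)} (hc : ConditionA c) : rowM c < ⊤ := by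
  refine lt_of_le_of_lt (iSup_mono fun i => ?_) hc.locality
  exact ENNReal.tsum_comp_le_tsum_of_injective Subtype.val_injective _

theorem influence_mono {a b : Site d → ℝ≥0∞} (h : ∀ i, a i ≤ b i) (j : Site d) :
    influence c a j ≤ influence c b j :=
  ENNReal.tsum_le_tsum fun i => by gcongr; exact h i

theorem influence_const_mul (r : ℝ≥0∞) (a : Site d → ℝ≥0∞) (j : Site d) :
    influence c (fun i => r * a i) j = r * influence c a j := by
  rw [influence, influence, ← ENNReal.tsum_mul_left]
  exact tsum_congr fun i => by ring

theorem tsum_influence_le (a : Site d → ℝ≥0∞) :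
    ∑' j, influence c a j ≤ rowM c * ∑' i, a i := by
  unfold influence
  rw [ENNReal.tsum_comm, ← ENNReal.tsum_mul_left]
  refine ENNReal.tsum_le_tsum fun i => ?_
  rw [ENNReal.tsum_mul_right]
  gcongr
  exact tsum_offDiag_row c i

/-- Schur's test: split each entry into two square roots, apply Cauchy–Schwarz and bound one factor
by the column sum; exchanging the sums then brings in the row sum. -/
theorem tsum_influence_sq_le_of_schur {M : ℝ≥0∞} (hr : rowM c ≤ M) (hl : colM c ≤ M)
    (a : Site d → ℝ≥0∞) : ∑' j, influence c a j ^ 2 ≤ M ^ 2 * ∑' i, a i ^ 2 := by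
  have h1 : ∀ j, influence c a j ^ 2 ≤ M * ∑' i, offDiag c i j * a i ^ 2 := fun j => by
    have hs : ∀ x : ℝ≥0∞, (x ^ (1 / 2 : ℝ)) ^ 2 = x := fun x => by
      rw [← ENNReal.rpow_two, ← ENNReal.rpow_mul]; norm_num
    have h := tsum_mul_sq_le (fun i => offDiag c i j ^ (1 / 2 : ℝ))
      (fun i => offDiag c i j ^ (1 / 2 : ℝ) * a i)
    simp only [mul_pow, hs, ← mul_assoc, ← sq] at h
    exact h.trans (by gcongr; exact (tsum_offDiag_col c j).trans hl)
  calc ∑' j, influence c a j ^ 2 ≤ ∑' j, M * ∑' i, offDiag c i j * a i ^ 2 :=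
        ENNReal.tsum_le_tsum h1
    _ = M * ∑' i, (∑' j, offDiag c i j) * a i ^ 2 := by
        rw [ENNReal.tsum_mul_left, ENNReal.tsum_comm]
        simp only [ENNReal.tsum_mul_right]
    _ ≤ M * ∑' i, M * a i ^ 2 := by
        gcongr with i
        exact (tsum_offDiag_row c i).trans hr
    _ = _ := by rw [ENNReal.tsum_mul_left, sq, mul_assoc]

/-- Duality: the hypothesis concerns `Γ`, the conclusion its transpose. With `b = influence c a`,
`‖b‖² ≤ ⟨a, Γ b⟩ ≤ ‖a‖ ‖Γ b‖`; after squaring, one factor `‖b‖²` cancels. -/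
theorem tsum_influence_sq_le_of_bounded {c : Site d → C(Config d, ℝ)} (hc : ConditionA c)
    {B : ℝ≥0} (hB : ∀ a : Site d → ℝ≥0∞,
      ∑' i, (∑' j, Gam c i j * a j) ^ 2 ≤ (B : ℝ≥0∞) * ∑' i, a i ^ 2)
    {a : Site d → ℝ≥0∞} (ha : ∑' i, a i ≠ ⊤) :
    ∑' j, influence c a j ^ 2 ≤ B * ∑' i, a i ^ 2 := by
  set b := influence c a with hb
  set s := ∑' j, b j ^ 2 with hs
  -- The cancellation needs `s` finite; this is where summability of `a` enters.
  have hfin : s ≠ ⊤ := tsum_sq_ne_top (ne_top_of_le_ne_top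
    (ENNReal.mul_ne_top (rowM_lt_top hc).ne ha) (tsum_influence_le c a))
  have h1 : s ≤ ∑' i, a i * ∑' j, Gam c i j * b j := by
    calc s = ∑' j, ∑' i, offDiag c i j * a i * b j := by
          refine tsum_congr fun j => ?_
          rw [ENNReal.tsum_mul_right, sq]; rfl
      _ = ∑' i, ∑' j, offDiag c i j * a i * b j := ENNReal.tsum_comm
      _ ≤ ∑' i, ∑' j, a i * (Gam c i j * b j) := by
          refine ENNReal.tsum_le_tsum fun i => ENNReal.tsum_le_tsum fun j => ?_
          calc offDiag c i j * a i * b j = a i * (offDiag c i j * b j) := by ring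
            _ ≤ _ := by gcongr; exact offDiag_le c i j
      _ = _ := by simp only [ENNReal.tsum_mul_left]
  have h2 : s * s ≤ (B * ∑' i, a i ^ 2) * s := by
    calc s * s = s ^ 2 := (sq s).symm
      _ ≤ (∑' i, a i * ∑' j, Gam c i j * b j) ^ 2 := by gcongr
      _ ≤ (∑' i, a i ^ 2) * ∑' i, (∑' j, Gam c i j * b j) ^ 2 := tsum_mul_sq_le _ _
      _ ≤ (∑' i, a i ^ 2) * (B * s) := by gcongr; exact hB b
      _ = _ := by ring
  rcases eq_or_ne s 0 with h0 | h0
  · rw [h0]; exact bot_le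
  · exact (ENNReal.mul_le_mul_iff_left h0 hfin).1 h2

/-- A summable sequence is dominated by a summable sequence which the influence operator enlarges
at most by a constant factor. -/
theorem exists_supersolution {c : Site d → C(Config d, ℝ)} (hc : ConditionA c)
    {a : Site d → ℝ≥0∞} (ha : ∑' i, a i ≠ ⊤) :
    ∃ (κ : ℝ≥0) (H : Site d → ℝ≥0∞), (∀ i, a i ≤ H i) ∧ ∑' i, H i ≠ ⊤ ∧
      ∀ i, influence c H i ≤ κ * H i := by
  set M := (rowM c).toNNReal with hM
  have hMc : (M : ℝ≥0∞) = rowM c := ENNReal.coe_toNNReal (rowM_lt_top hc).ne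
  -- With `T` the influence operator, the witness is `H = ∑_k κ⁻ᵏ Tᵏ a`. It is summable because `T`
  -- has `ℓ¹` bound `M < κ`, and `T H ≤ κ H` because `T` shifts the series by one index.
  set κ : ℝ≥0 := M + 1
  have hκ : (κ : ℝ≥0∞) ≠ 0 := by simp [κ]
  set b : ℕ → Site d → ℝ≥0∞ := fun k => (influence c)^[k] a
  have hb : ∀ k, b (k + 1) = influence c (b k) := fun k => Function.iterate_succ_apply' _ _ _
  have hsum : ∀ k, ∑' i, b k i ≤ (M : ℝ≥0∞) ^ k * ∑' i, a i := by
    intro k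
    induction k with
    | zero => simp [b]
    | succ k ih =>
      rw [hb]
      refine (tsum_influence_le c _).trans ?_
      rw [pow_succ', mul_assoc, ← hMc]
      gcongr
  refine ⟨κ, fun i => ∑' k, (κ : ℝ≥0∞)⁻¹ ^ k * b k i, fun i => ?_, ?_, fun i => ?_⟩
  · refine le_trans (le_of_eq ?_) (ENNReal.le_tsum 0)
    simp [b]
  · rw [ENNReal.tsum_comm]
    have h1 : ∀ k, ∑' i, (κ : ℝ≥0∞)⁻¹ ^ k * b k i
        ≤ ((κ : ℝ≥0∞)⁻¹ * M) ^ k * ∑' i, a i := fun k => by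
      rw [ENNReal.tsum_mul_left, mul_pow, mul_assoc]
      gcongr
      exact hsum k
    refine ne_top_of_le_ne_top ?_ (ENNReal.tsum_le_tsum h1)
    rw [ENNReal.tsum_mul_right, ENNReal.tsum_geometric]
    refine ENNReal.mul_ne_top (ENNReal.inv_ne_top.2 ?_) ha
    rw [← pos_iff_ne_zero, tsub_pos_iff_lt, mul_comm, ← div_eq_mul_inv]
    refine ENNReal.div_lt_of_lt_mul ?_
    rw [one_mul]
    exact_mod_cast lt_add_one M
  · have h1 : influence c (fun i => ∑' k, (κ : ℝ≥0∞)⁻¹ ^ k * b k i) i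
        = ∑' k, (κ : ℝ≥0∞)⁻¹ ^ k * b (k + 1) i := by
      simp only [hb, ← influence_const_mul]
      unfold influence
      simp only [← ENNReal.tsum_mul_left]
      exact ENNReal.tsum_comm
    rw [h1, ← ENNReal.tsum_mul_left]
    refine le_trans (le_of_eq (tsum_congr fun k => ?_))
      (ENNReal.tsum_comp_le_tsum_of_injective Nat.succ_injective
        fun k => (κ : ℝ≥0∞) * ((κ : ℝ≥0∞)⁻¹ ^ k * b k i))
    rw [Nat.succ_eq_add_one, pow_succ', ← mul_assoc, ← mul_assoc,
      ENNReal.mul_inv_cancel hκ ENNReal.coe_ne_top, one_mul]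

end

/-! ### Finite-volume generators and Euler steps -/

/-- The generator of the dynamics in which only the spins in `B` flip. -/
noncomputable def flipGen (c : Site d → C(Config d, ℝ)) (B : Finset (Site d)) :
    C(Config d, ℝ) →ₗ[ℝ] C(Config d, ℝ) where
  toFun f := ∑ i ∈ B, c i * (f.comp (flipMap i) - f)
  map_add' f g := by
    rw [← Finset.sum_add_distrib]
    refine Finset.sum_congr rfl fun i _ => ?_
    ext σ; simp; ring
  map_smul' r f := by
    rw [RingHom.id_apply, Finset.smul_sum]
    refine Finset.sum_congr rfl fun i _ => ?_
    ext σ; simp; ring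

theorem flipGen_apply (c : Site d → C(Config d, ℝ)) (B : Finset (Site d)) (f : C(Config d, ℝ))
    (σ : Config d) : flipGen c B f σ = ∑ i ∈ B, c i σ * (f (flip i σ) - f σ) := by
  simp [flipGen, ContinuousMap.sum_apply]

theorem flipGen_mem_pregeneratorGraph (c : Site d → C(Config d, ℝ)) {B : Finset (Site d)}
    {f : C(Config d, ℝ)} (hf : DependsOn f (B : Set (Site d))) :
    (f, flipGen c B f) ∈ pregeneratorGraph c := by
  refine ⟨⟨B, hf⟩, fun σ => ?_⟩
  rw [flipGen_apply, tsum_eq_sum]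
  intro i hi
  rw [apply_flip_of_dependsOn hf hi, sub_self, mul_zero]

/-- The rates with the spins outside `B` frozen. -/
noncomputable def frozenRates (c : Site d → C(Config d, ℝ)) (B : Finset (Site d)) (i : Site d) :
    C(Config d, ℝ) :=
  (c i).comp (freeze B)

/-- The Euler step of length `h` for the frozen dynamics in `B`. -/
noncomputable def eulerStep (c : Site d → C(Config d, ℝ)) (B : Finset (Site d)) (h : ℝ)
    (f : C(Config d, ℝ)) : C(Config d, ℝ) :=
  f + h • flipGen (frozenRates c B) B f

theorem eulerStep_apply (c : Site d → C(Config d, ℝ)) (B : Finset (Site d)) (h : ℝ)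
    (f : C(Config d, ℝ)) (σ : Config d) : eulerStep c B h f σ
      = f σ + h * ∑ i ∈ B, c i (freeze B σ) * (f (flip i σ) - f σ) := by
  simp [eulerStep, flipGen_apply, frozenRates]

theorem dependsOn_comp_flip {f : Config d → ℝ} {B : Finset (Site d)}
    (hf : DependsOn f (B : Set (Site d))) (i : Site d) :
    DependsOn (fun σ => f (flip i σ)) (B : Set (Site d)) := by
  intro σ ξ h
  refine hf fun j hj => ?_
  by_cases hji : j = i
  · subst hji; simp [flip, h j hj]
  · rw [flip_of_ne hji, flip_of_ne hji, h j hj]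

/-- The reason for freezing the rates: iterates stay in one finite-dimensional space of local
functions. -/
theorem dependsOn_eulerStep {c : Site d → C(Config d, ℝ)} {B : Finset (Site d)} {h : ℝ}
    {f : C(Config d, ℝ)} (hf : DependsOn f (B : Set (Site d))) :
    DependsOn (eulerStep c B h f) (B : Set (Site d)) := by
  intro σ ξ hσ
  rw [eulerStep_apply, eulerStep_apply, show f σ = f ξ from hf hσ, freeze_congr hσ]
  congr 2
  refine Finset.sum_congr rfl fun i _ => ?_
  rw [show f (flip i σ) = f (flip i ξ) from dependsOn_comp_flip hf i hσ]

section Euler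

variable {c : Site d → C(Config d, ℝ)} {B : Finset (Site d)} {h : ℝ}

/-- For small `h` the step takes a convex combination of the values of `f` at `σ` and at its flips.
-/
theorem norm_eulerStep_le (hc : ∀ i σ, 0 ≤ c i σ) (h0 : 0 ≤ h)
    (hB : h * (2 * ∑ i ∈ B, ‖c i‖) ≤ 1) (f : C(Config d, ℝ)) : ‖eulerStep c B h f‖ ≤ ‖f‖ := by
  refine (ContinuousMap.norm_le _ (norm_nonneg f)).2 fun σ => ?_
  set r := ∑ i ∈ B, c i (freeze B σ) with hr
  have hr0 : 0 ≤ r := Finset.sum_nonneg fun i _ => hc i _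
  have hr1 : r ≤ ∑ i ∈ B, ‖c i‖ :=
    Finset.sum_le_sum fun i _ => (le_abs_self _).trans ((c i).norm_coe_le_norm _)
  have hr2 : h * r ≤ 1 := by nlinarith
  have h1 : eulerStep c B h f σ
      = (1 - h * r) * f σ + h * ∑ i ∈ B, c i (freeze B σ) * f (flip i σ) := by
    rw [eulerStep_apply]
    simp only [mul_sub, Finset.sum_sub_distrib, ← Finset.sum_mul]
    rw [← hr]; ring
  have h2 : |∑ i ∈ B, c i (freeze B σ) * f (flip i σ)| ≤ r * ‖f‖ := by
    rw [hr, Finset.sum_mul]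
    refine (Finset.abs_sum_le_sum_abs _ _).trans (Finset.sum_le_sum fun i _ => ?_)
    rw [abs_mul, abs_of_nonneg (hc i _)]
    exact mul_le_mul_of_nonneg_left (f.norm_coe_le_norm _) (hc i _)
  have h3 : |f σ| ≤ ‖f‖ := f.norm_coe_le_norm σ
  rw [h1, Real.norm_eq_abs]
  calc _ ≤ |(1 - h * r) * f σ| + |h * ∑ i ∈ B, c i (freeze B σ) * f (flip i σ)| := abs_add_le _ _
    _ ≤ (1 - h * r) * ‖f‖ + h * (r * ‖f‖) := by
        rw [abs_mul, abs_mul, abs_of_nonneg (sub_nonneg.2 hr2), abs_of_nonneg h0]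
        exact add_le_add (mul_le_mul_of_nonneg_left h3 (sub_nonneg.2 hr2))
          (mul_le_mul_of_nonneg_left h2 h0)
    _ = ‖f‖ := by ring

/-- Let `A = f(σ^x) - f(σ)`. The flip at `x` contributes `-(c(x,ξ) + c(x,ξ^x)) A`; a flip at `u ≠ x`
contributes at most `Γ_{ux} δ_u f + c(u,ξ) (δ_x f - A)`. For small `h` the total coefficient of `A`
is nonnegative, so `A` may be replaced by `δ_x f`; the rates at `u ≠ x` then cancel. -/
theorem eulerStep_flip_sub_le (hc : ∀ i σ, 0 ≤ c i σ) {ε : ℝ}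
    (hε : ∀ i σ, ε ≤ c i σ + c i (flip i σ)) (h0 : 0 ≤ h)
    (hB : h * (2 * ∑ i ∈ B, ‖c i‖) ≤ 1) (f : C(Config d, ℝ)) {x : Site d} (hx : x ∈ B)
    (σ : Config d) :
    eulerStep c B h f (flip x σ) - eulerStep c B h f σ
      ≤ (1 - h * ε) * (delta f x).toReal
        + h * ∑ u ∈ B.erase x, (Gam c u x).toReal * (delta f u).toReal := by
  set ξ := freeze B σ with hξ
  set A := f (flip x σ) - f σ with hA
  set D := fun u => (delta f u).toReal with hD
  have hAD : A ≤ D x := (le_abs_self _).trans (abs_sub_le_delta_toReal f x σ)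
  have hD0 : 0 ≤ D x := ENNReal.toReal_nonneg
  set r := ∑ u ∈ B.erase x, c u ξ with hr
  have hterm : ∀ u ∈ B.erase x,
      c u (flip x ξ) * (f (flip u (flip x σ)) - f (flip x σ)) - c u ξ * (f (flip u σ) - f σ)
        ≤ (Gam c u x).toReal * D u + c u ξ * (D x - A) := by
    intro u _
    have h1 : |c u (flip x ξ) - c u ξ| ≤ (Gam c u x).toReal := abs_sub_le_delta_toReal (c u) x ξ
    have h2 : |f (flip u (flip x σ)) - f (flip x σ)| ≤ D u := abs_sub_le_delta_toReal f u _
    have h3 : f (flip x (flip u σ)) - f (flip u σ) ≤ D x :=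
      (le_abs_self _).trans (abs_sub_le_delta_toReal f x _)
    have h4 : (c u (flip x ξ) - c u ξ) * (f (flip u (flip x σ)) - f (flip x σ))
        ≤ (Gam c u x).toReal * D u := by
      refine (le_abs_self _).trans ?_
      rw [abs_mul]
      exact mul_le_mul h1 h2 (abs_nonneg _) ENNReal.toReal_nonneg
    have h5 := mul_le_mul_of_nonneg_left h3 (hc u ξ)
    rw [flip_comm x u] at h5
    simp only [hA]
    linarith
  have hsum := Finset.sum_le_sum hterm
  rw [Finset.sum_sub_distrib, Finset.sum_add_distrib, ← Finset.sum_mul, ← hr] at hsum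
  -- The rate at `x` occurs in both configurations, whence the factor `2`.
  have hr1 : r + (c x ξ + c x (flip x ξ)) ≤ 2 * ∑ i ∈ B, ‖c i‖ := by
    have h1 : ∀ i η, c i η ≤ ‖c i‖ := fun i η =>
      (le_abs_self _).trans ((c i).norm_coe_le_norm η)
    have h2 : r + c x ξ ≤ ∑ i ∈ B, ‖c i‖ := by
      rw [hr, Finset.sum_erase_add _ _ hx]
      exact Finset.sum_le_sum fun i _ => h1 i ξ
    have h3 : c x (flip x ξ) ≤ ∑ i ∈ B, ‖c i‖ :=
      (h1 x _).trans (Finset.single_le_sum (f := fun i => ‖c i‖) (fun i _ => norm_nonneg _) hx)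
    linarith
  have hr2 : h * (r + (c x ξ + c x (flip x ξ))) ≤ 1 :=
    (mul_le_mul_of_nonneg_left hr1 h0).trans hB
  have hε' : 0 ≤ h * (c x ξ + c x (flip x ξ) - ε) * D x :=
    mul_nonneg (mul_nonneg h0 (sub_nonneg.2 (hε x ξ))) hD0
  rw [eulerStep_apply, eulerStep_apply, freeze_flip_of_mem hx, ← hξ,
    ← Finset.sum_erase_add _ _ hx, ← Finset.sum_erase_add _ _ hx, flip_flip]
  have h6 := mul_le_mul_of_nonneg_left hsum h0
  have h7 := mul_nonneg (sub_nonneg.2 hAD) (sub_nonneg.2 hr2)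
  have h8 : f σ - f (flip x σ) = -A := by rw [hA]; ring
  have h9 : f (flip x σ) = f σ + A := by rw [hA]; ring
  rw [h8]
  simp only [h9] at h6 ⊢
  simp only [hD] at *
  nlinarith

theorem delta_eulerStep_le (hc : ∀ i σ, 0 ≤ c i σ) {ε : ℝ}
    (hε : ∀ i σ, ε ≤ c i σ + c i (flip i σ)) (h0 : 0 ≤ h) (hhε : h * ε ≤ 1)
    (hB : h * (2 * ∑ i ∈ B, ‖c i‖) ≤ 1) {f : C(Config d, ℝ)}
    (hf : DependsOn f (B : Set (Site d))) (x : Site d) :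
    delta (eulerStep c B h f) x
      ≤ ENNReal.ofReal (1 - h * ε) * delta f x + ENNReal.ofReal h * influence c (delta f) x := by
  by_cases hx : x ∈ B
  · refine delta_le fun σ => (ENNReal.ofReal_le_ofReal
      (eulerStep_flip_sub_le hc hε h0 hB f hx σ)).trans ?_
    refine ENNReal.ofReal_add_le.trans ?_
    rw [ENNReal.ofReal_mul (sub_nonneg.2 hhε), ENNReal.ofReal_toReal (delta_ne_top f x),
      ENNReal.ofReal_mul h0]
    gcongr
    rw [ENNReal.ofReal_sum_of_nonneg fun u _ =>
      mul_nonneg ENNReal.toReal_nonneg ENNReal.toReal_nonneg]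
    refine le_trans (Finset.sum_le_sum fun u hu => ?_) (ENNReal.sum_le_tsum (B.erase x))
    rw [ENNReal.ofReal_mul ENNReal.toReal_nonneg, ENNReal.ofReal_toReal (delta_ne_top f u),
      ENNReal.ofReal_toReal (show Gam c u x ≠ ⊤ from delta_ne_top (c u) x), offDiag,
      if_neg (Finset.ne_of_mem_erase hu).symm]
  · rw [delta_eq_zero (dependsOn_eulerStep hf) hx]
    exact bot_le

/-- Freezing changes `c i` by at most `∑_{j ∉ B} Γ_{ij}`. Weighted by `δ_i f` and summed over `i`,
this is a tail of `influence c (delta f)`, small for large `B` if that sequence is summable. -/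
theorem ofReal_abs_flipGen_sub_le (f : C(Config d, ℝ)) (σ : Config d) :
    ENNReal.ofReal |flipGen c B f σ - flipGen (frozenRates c B) B f σ|
      ≤ ∑' j : {j : Site d // j ∉ B}, influence c (delta f) j := by
  have h1 : ∀ i ∈ B, ENNReal.ofReal |c i σ - c i (freeze B σ)|
      ≤ ∑' j : {j : Site d // j ∉ B}, offDiag c i j := by
    intro i hi
    refine (ofReal_abs_sub_le_tsum (c i) σ (freeze B σ)).trans ?_
    refine le_trans ?_ (tsum_subtype {j | j ∉ B} (offDiag c i)).ge
    refine ENNReal.tsum_le_tsum fun j => ?_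
    by_cases hj : j ∈ B
    · simp [freeze_of_mem hj]
    · have hji : j ≠ i := fun h => hj (h ▸ hi)
      rw [Set.indicator_of_mem (by exact hj), offDiag, if_neg hji, Gam]
      split_ifs <;> simp
  rw [flipGen_apply, flipGen_apply, ← Finset.sum_sub_distrib]
  calc _ ≤ ∑ i ∈ B, ENNReal.ofReal |c i σ - c i (freeze B σ)| * delta f i := by
        refine (ENNReal.ofReal_le_ofReal (Finset.abs_sum_le_sum_abs _ _)).trans ?_
        rw [ENNReal.ofReal_sum_of_nonneg fun _ _ => abs_nonneg _]
        refine Finset.sum_le_sum fun i _ => ?_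
        rw [frozenRates, ContinuousMap.comp_apply, ← sub_mul, abs_mul,
          ENNReal.ofReal_mul (abs_nonneg _)]
        gcongr
        exact ofReal_abs_sub_le_delta f i σ
    _ ≤ ∑ i ∈ B, (∑' j : {j : Site d // j ∉ B}, offDiag c i j) * delta f i :=
        Finset.sum_le_sum fun i hi => by gcongr; exact h1 i hi
    _ ≤ ∑' i, (∑' j : {j : Site d // j ∉ B}, offDiag c i j) * delta f i := ENNReal.sum_le_tsum _
    _ = _ := by
        simp only [← ENNReal.tsum_mul_right]
        exact ENNReal.tsum_comm

end Euler

/-! ### Expansion of a local function in cylinder indicators -/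

open Classical in
/-- The indicator of the cylinder of configurations which agree with `ξ` in `B`. -/
noncomputable def cylinder (B : Finset (Site d)) (ξ : B → ℤˣ) : C(Config d, ℝ) :=
  ⟨fun σ => if (fun i : B => σ i) = ξ then 1 else 0,
    (continuous_of_discreteTopology (f := fun ζ : B → ℤˣ => if ζ = ξ then (1 : ℝ) else 0)).comp
      (continuous_pi fun i : B => continuous_apply (i : Site d))⟩

open Classical in
/-- The extension by `1` of a configuration in `B`. -/
noncomputable def extend (B : Finset (Site d)) (ξ : B → ℤˣ) : Config d :=
  fun i => if h : i ∈ B then ξ ⟨i, h⟩ else 1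

/-- Finitely many cylinders span the functions of the spins in `B`, so convergence of difference
quotients on each of them is uniform on bounded sets of such functions. -/
theorem eq_sum_cylinder {B : Finset (Site d)} {f : C(Config d, ℝ)}
    (hf : DependsOn f (B : Set (Site d))) :
    f = ∑ ξ : B → ℤˣ, f (extend B ξ) • cylinder B ξ := by
  ext σ
  simp only [ContinuousMap.sum_apply, ContinuousMap.smul_apply, cylinder, ContinuousMap.coe_mk,
    smul_eq_mul, mul_ite, mul_one, mul_zero, Finset.sum_ite_eq, Finset.mem_univ, if_true]
  refine hf fun i hi => ?_
  rw [extend, dif_pos (Finset.mem_coe.1 hi)]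

theorem dependsOn_cylinder (B : Finset (Site d)) (ξ : B → ℤˣ) :
    DependsOn (cylinder B ξ) (B : Set (Site d)) := by
  intro σ η h
  have : (fun i : B => σ i) = fun i : B => η i := funext fun i => h i i.2
  simp only [cylinder, ContinuousMap.coe_mk, this]

/-! ### Contractivity of the semigroup and its approximation by Euler steps -/

namespace MarkovSemigroup

variable (S : MarkovSemigroup d)

theorem op_mono (t : ℝ≥0) {f g : C(Config d, ℝ)} (h : f ≤ g) : S.op t f ≤ S.op t g := by
  have := S.op_nonneg t (g - f) (sub_nonneg.2 h)
  rw [map_sub] at this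
  exact sub_nonneg.1 this

theorem op_const (t : ℝ≥0) (r : ℝ) :
    S.op t (ContinuousMap.const _ r) = ContinuousMap.const _ r := by
  have h : (ContinuousMap.const (Config d) r) = r • 1 := by ext; simp
  rw [h, map_smul, S.op_one]

theorem norm_op_le (t : ℝ≥0) (f : C(Config d, ℝ)) : ‖S.op t f‖ ≤ ‖f‖ := by
  refine (ContinuousMap.norm_le _ (norm_nonneg f)).2 fun σ => ?_
  have h1 := S.op_mono t (f := f) (g := ContinuousMap.const _ ‖f‖)
    fun σ => (le_abs_self _).trans (f.norm_coe_le_norm σ)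
  have h2 := S.op_mono t (f := ContinuousMap.const _ (-‖f‖)) (g := f)
    fun σ => neg_le_of_abs_le (f.norm_coe_le_norm σ)
  rw [op_const] at h1 h2
  exact abs_le.2 ⟨h2 σ, h1 σ⟩

theorem continuous_op (t : ℝ≥0) : Continuous (S.op t) :=
  AddMonoidHomClass.continuous_of_bound (S.op t) 1 fun f => by
    rw [one_mul]; exact S.norm_op_le t f

variable {S} {c : Site d → C(Config d, ℝ)}

/-- The difference quotients converge to the generator uniformly on bounded sets of functions
which depend on the spins in `B`. -/
theorem IsGeneratedBy.eventually_norm_sub_le (hS : S.IsGeneratedBy c) (B : Finset (Site d))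
    {η : ℝ} (hη : 0 < η) :
    ∀ᶠ h : ℝ≥0 in 𝓝[>] 0, ∀ f : C(Config d, ℝ), DependsOn f (B : Set (Site d)) →
      ‖(h : ℝ)⁻¹ • (S.op h f - f) - flipGen c B f‖ ≤ ‖f‖ * η := by
  have h1 : ∀ ξ : B → ℤˣ, Tendsto (fun h : ℝ≥0 =>
      ‖(h : ℝ)⁻¹ • (S.op h (cylinder B ξ) - cylinder B ξ) - flipGen c B (cylinder B ξ)‖)
      (𝓝[>] 0) (𝓝 0) := fun ξ => by
    have h2 : (cylinder B ξ, flipGen c B (cylinder B ξ)) ∈ S.generatorGraph := by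
      rw [show S.generatorGraph = _ from hS]
      exact subset_closure (flipGen_mem_pregeneratorGraph c (dependsOn_cylinder B ξ))
    exact tendsto_iff_norm_sub_tendsto_zero.1 h2
  have h3 := tendsto_finsetSum (Finset.univ : Finset (B → ℤˣ)) fun ξ _ => h1 ξ
  rw [Finset.sum_const_zero] at h3
  filter_upwards [h3.eventually (ge_mem_nhds hη)] with h hh f hf
  have h4 : (h : ℝ)⁻¹ • (S.op h f - f) - flipGen c B f = ∑ ξ : B → ℤˣ, f (extend B ξ) •
      ((h : ℝ)⁻¹ • (S.op h (cylinder B ξ) - cylinder B ξ) - flipGen c B (cylinder B ξ)) := by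
    conv_lhs => rw [eq_sum_cylinder hf]
    simp only [map_sum, map_smul, ← Finset.sum_sub_distrib, Finset.smul_sum]
    refine Finset.sum_congr rfl fun ξ _ => ?_
    ext σ
    simp only [ContinuousMap.sub_apply, ContinuousMap.smul_apply, smul_eq_mul]
    ring
  rw [h4]
  refine (norm_sum_le _ _).trans (le_trans (Finset.sum_le_sum fun ξ _ => ?_)
    ((Finset.mul_sum _ _ _).ge.trans (mul_le_mul_of_nonneg_left hh (norm_nonneg f))))
  rw [norm_smul]
  exact mul_le_mul_of_nonneg_right (f.norm_coe_le_norm _) (norm_nonneg _)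

theorem tendsto_div_natCast {t : ℝ≥0} (ht : 0 < t) :
    Tendsto (fun m : ℕ => t / (m : ℝ≥0)) atTop (𝓝[>] 0) := by
  refine tendsto_nhdsWithin_iff.2 ⟨?_, ?_⟩
  · exact tendsto_const_div_atTop_nhds_zero_nat t
  · filter_upwards [eventually_gt_atTop 0] with m hm
    exact div_pos ht (by exact_mod_cast hm)

/-- A step multiplies the majorant `H` by at most `1 + hκ`, since `influence c H ≤ κ H`. The
resulting bound does not depend on `B`, so `B` can be chosen afterwards. -/
theorem iterate_eulerStep_bounds (hc : ∀ i σ, 0 ≤ c i σ) {B : Finset (Site d)} {h : ℝ}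
    (h0 : 0 ≤ h) (hB : h * (2 * ∑ i ∈ B, ‖c i‖) ≤ 1) {g : C(Config d, ℝ)}
    (hg : DependsOn g (B : Set (Site d))) {κ : ℝ≥0} {H : Site d → ℝ≥0∞}
    (hgH : ∀ i, delta g i ≤ H i) (hH : ∀ i, influence c H i ≤ κ * H i) (k : ℕ) :
    DependsOn ((eulerStep c B h)^[k] g) (B : Set (Site d)) ∧
      ‖(eulerStep c B h)^[k] g‖ ≤ ‖g‖ ∧
      ∀ i, delta ((eulerStep c B h)^[k] g) i ≤ ENNReal.ofReal (Real.exp (k * h * κ)) * H i := by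
  induction k with
  | zero => simpa using ⟨hg, hgH⟩
  | succ k ih =>
    rw [Function.iterate_succ_apply']
    obtain ⟨h1, h2, h3⟩ := ih
    refine ⟨dependsOn_eulerStep h1, (norm_eulerStep_le hc h0 hB _).trans h2, fun i => ?_⟩
    refine (delta_eulerStep_le hc (ε := 0) (fun i σ => add_nonneg (hc i _) (hc i _)) h0 (by simp)
      hB h1 i).trans ?_
    have h4 := influence_mono c h3 i
    rw [influence_const_mul] at h4
    set r := ENNReal.ofReal (Real.exp (k * h * κ))
    calc _ ≤ 1 * (r * H i) + ENNReal.ofReal h * (r * (κ * H i)) := by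
          rw [mul_zero, sub_zero, ENNReal.ofReal_one]
          gcongr
          · exact h3 i
          · exact h4.trans (by gcongr; exact hH i)
      _ = ENNReal.ofReal (1 + h * κ) * r * H i := by
          rw [ENNReal.ofReal_add zero_le_one (by positivity), ENNReal.ofReal_mul h0,
            ENNReal.ofReal_one, ENNReal.ofReal_coe_nnreal]
          ring
      _ ≤ ENNReal.ofReal (Real.exp (h * κ)) * r * H i := by
          gcongr
          rw [add_comm]; exact Real.add_one_le_exp _
      _ = _ := by
          rw [← ENNReal.ofReal_mul (Real.exp_pos _).le, ← Real.exp_add]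
          congr 3
          push_cast; ring

/-- Euler steps of the frozen dynamics approximate the semigroup on local functions. -/
theorem IsGeneratedBy.exists_eulerStep_approx (hS : S.IsGeneratedBy c) (hc : ConditionA c)
    {B₀ : Finset (Site d)} {g : C(Config d, ℝ)} (hg : DependsOn g (B₀ : Set (Site d)))
    {t : ℝ≥0} (ht : 0 < t) {η : ℝ} (hη : 0 < η) :
    ∃ B, B₀ ⊆ B ∧ ∀ᶠ m : ℕ in atTop,
      ‖S.op t g - (eulerStep c B ((t / m : ℝ≥0) : ℝ))^[m] g‖ ≤ η := by
  have hpos : ∀ i σ, 0 ≤ c i σ := by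
    obtain ⟨m, hm, hm'⟩ := hc.pos
    exact fun i σ => hm.le.trans (hm' i σ)
  obtain ⟨κ, H, hgH, hHfin, hH⟩ := exists_supersolution hc (tsum_delta_ne_top ⟨B₀, hg⟩)
  set R := ENNReal.ofReal (Real.exp (t * κ)) with hR
  have hfin : ∑' j, R * influence c H j ≠ ⊤ := by
    rw [ENNReal.tsum_mul_left]
    exact ENNReal.mul_ne_top ENNReal.ofReal_ne_top (ne_top_of_le_ne_top
      (ENNReal.mul_ne_top (rowM_lt_top hc).ne hHfin) (tsum_influence_le c H))
  have ht' : (0 : ℝ) < t := ht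
  -- Each of the `m = t / h` steps may err by `h η₂` from the difference quotient and by `h η₂` from
  -- freezing, in total `2 t η₂ = η`. Below, `η₁` is chosen so that `‖g‖ η₁ ≤ η₂`.
  set η₂ : ℝ := η / (2 * t) with hη₂
  have hη₂0 : 0 < η₂ := by positivity
  set η₁ : ℝ := η₂ / (‖g‖ + 1) with hη₁
  have hη₁0 : 0 < η₁ := by positivity
  have htail := (ENNReal.tendsto_tsum_compl_atTop_zero hfin).eventually
    (ge_mem_nhds (ENNReal.ofReal_pos.2 hη₂0))
  obtain ⟨B, hB, hB₀⟩ := (htail.and (eventually_ge_atTop B₀)).exists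
  refine ⟨B, hB₀, ?_⟩
  have hgB : DependsOn g (B : Set (Site d)) := fun σ ξ h => hg fun i hi => h i (hB₀ hi)
  have hsmall : ∀ᶠ h : ℝ≥0 in 𝓝[>] 0, (h : ℝ) * (2 * ∑ i ∈ B, ‖c i‖) ≤ 1 := by
    have : Tendsto (fun h : ℝ≥0 => (h : ℝ) * (2 * ∑ i ∈ B, ‖c i‖)) (𝓝 0) (𝓝 0) := by
      have h := (NNReal.continuous_coe.tendsto 0).mul_const (2 * ∑ i ∈ B, ‖c i‖)
      simpa using h
    exact (this.mono_left nhdsWithin_le_nhds).eventually (ge_mem_nhds one_pos)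
  filter_upwards [(tendsto_div_natCast ht).eventually hsmall,
    (tendsto_div_natCast ht).eventually (hS.eventually_norm_sub_le B hη₁0),
    eventually_gt_atTop 0] with m hm1 hm2 hm0
  set h : ℝ≥0 := t / m with hh
  have hmh : (m : ℝ) * h = t := by
    rw [hh, NNReal.coe_div, NNReal.coe_natCast]
    field_simp
  have hmh' : (m : ℝ≥0) * h = t := by exact_mod_cast hmh
  have hh0 : (0 : ℝ) < h := by
    have : 0 < h := div_pos ht (by exact_mod_cast hm0)
    exact_mod_cast this
  set E := eulerStep c B h with hE
  have hstep : ∀ k ≤ m, ‖S.op h (E^[k] g) - E (E^[k] g)‖ ≤ h * (2 * η₂) := by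
    intro k hk
    obtain ⟨h1, h2, h3⟩ := iterate_eulerStep_bounds hpos hh0.le hm1 hgB hgH hH k
    set f := E^[k] g
    have h4 : S.op h f - E f = (h : ℝ) • (((h : ℝ)⁻¹ • (S.op h f - f) - flipGen c B f)
        + (flipGen c B f - flipGen (frozenRates c B) B f)) := by
      ext σ
      simp only [hE, eulerStep, ContinuousMap.sub_apply, ContinuousMap.add_apply,
        ContinuousMap.smul_apply, smul_eq_mul]
      field_simp
      ring
    have h5 : ‖flipGen c B f - flipGen (frozenRates c B) B f‖ ≤ η₂ := by
      refine (ContinuousMap.norm_le _ hη₂0.le).2 fun σ => ?_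
      refine (ENNReal.ofReal_le_ofReal_iff hη₂0.le).1 ?_
      refine (ofReal_abs_flipGen_sub_le f σ).trans (le_trans ?_ hB)
      refine ENNReal.tsum_le_tsum fun j => ?_
      rw [← influence_const_mul]
      refine influence_mono c (fun i => (h3 i).trans ?_) j
      gcongr
      rw [hR, ← hmh]
      gcongr
    have h6 : ‖(h : ℝ)⁻¹ • (S.op h f - f) - flipGen c B f‖ ≤ η₂ := by
      refine (hm2 f h1).trans ((mul_le_mul_of_nonneg_right h2 hη₁0.le).trans ?_)
      rw [hη₁, mul_div_assoc', div_le_iff₀ (by positivity)]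
      nlinarith
    rw [h4, norm_smul, Real.norm_of_nonneg hh0.le]
    refine mul_le_mul_of_nonneg_left ((norm_add_le _ _).trans ?_) hh0.le
    linarith
  have hind : ∀ k ≤ m, ‖S.op (k * h) g - E^[k] g‖ ≤ k * (h * (2 * η₂)) := by
    intro k
    induction k with
    | zero => intro _; simp [S.op_zero]
    | succ k ih =>
      intro hk
      -- As `S.op h` is a contraction, earlier errors are not amplified and the one-step errors just
      -- add up.
      have h1 : S.op ((k + 1 : ℕ) * h) g - E^[k + 1] g
          = S.op h (S.op (k * h) g - E^[k] g) + (S.op h (E^[k] g) - E (E^[k] g)) := by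
        rw [Function.iterate_succ_apply', map_sub, ← LinearMap.comp_apply, ← S.op_add,
          show h + k * h = ((k + 1 : ℕ) : ℝ≥0) * h by push_cast; ring]
        abel
      rw [h1]
      have h2 := (S.norm_op_le h _).trans (ih (by omega))
      have h3 := hstep k (by omega)
      refine (norm_add_le _ _).trans ((add_le_add h2 h3).trans (le_of_eq ?_))
      push_cast; ring
  have h7 := hind m le_rfl
  rw [hmh', ← mul_assoc, hmh] at h7
  refine h7.trans (le_of_eq ?_)
  rw [hη₂]; field_simp

/-- A bound on the influence operator in a norm `N` yields an exponential bound on the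
oscillations of the evolved local functions in that norm. -/
theorem IsGeneratedBy.norm_delta_op_le (hS : S.IsGeneratedBy c) (hc : ConditionA c) {ε b : ℝ}
    (hε : ∀ i σ, ε ≤ c i σ + c i (flip i σ)) (hb : 0 ≤ b) (N : (Site d → ℝ≥0∞) → ℝ≥0∞)
    (hclosed : ∀ r, IsClosed {f : C(Config d, ℝ) | N (delta f) ≤ r})
    (hmono : ∀ a a', (∀ i, a i ≤ a' i) → N a ≤ N a')
    (hadd : ∀ a a', N (fun i => a i + a' i) ≤ N a + N a')
    (hmul : ∀ (r : ℝ≥0∞) a, N (fun i => r * a i) = r * N a)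
    (hT : ∀ a, ∑' i, a i ≠ ⊤ → N (influence c a) ≤ ENNReal.ofReal b * N a)
    {g : C(Config d, ℝ)} (hg : IsLocal g) (t : ℝ≥0) :
    N (delta (S.op t g)) ≤ ENNReal.ofReal (Real.exp (t * (b - ε))) * N (delta g) := by
  rcases eq_or_ne t 0 with rfl | ht
  · simp [S.op_zero]
  have ht : 0 < t := pos_iff_ne_zero.2 ht
  obtain ⟨B₀, hB₀⟩ := hg
  have hpos : ∀ i σ, 0 ≤ c i σ := by
    obtain ⟨m, hm, hm'⟩ := hc.pos
    exact fun i σ => hm.le.trans (hm' i σ)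
  -- The sublevel set is closed, so it suffices to find Euler iterates in it arbitrarily close to
  -- `S.op t g`.
  refine (hclosed _).closure_subset (Metric.mem_closure_iff.2 fun η hη => ?_)
  obtain ⟨B, hB, hm⟩ := hS.exists_eulerStep_approx hc hB₀ ht (half_pos hη)
  have hgB : DependsOn g (B : Set (Site d)) := fun σ ξ h => hB₀ fun i hi => h i (hB hi)
  have hsmall : ∀ r : ℝ, ∀ᶠ h : ℝ≥0 in 𝓝[>] 0, (h : ℝ) * r ≤ 1 := fun r => by
    have : Tendsto (fun h : ℝ≥0 => (h : ℝ) * r) (𝓝 0) (𝓝 0) := by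
      have h := (NNReal.continuous_coe.tendsto 0).mul_const r
      simpa using h
    exact (this.mono_left nhdsWithin_le_nhds).eventually (ge_mem_nhds one_pos)
  obtain ⟨m, hm, hm0, hm1, hm2⟩ := (hm.and ((eventually_gt_atTop 0).and
    (((tendsto_div_natCast ht).eventually (hsmall (2 * ∑ i ∈ B, ‖c i‖))).and
    ((tendsto_div_natCast ht).eventually (hsmall ε))))).exists
  set h : ℝ≥0 := t / m with hh
  have hmh : (m : ℝ) * h = t := by
    rw [hh, NNReal.coe_div, NNReal.coe_natCast]
    field_simp
  refine ⟨(eulerStep c B h)^[m] g, ?_, by rw [dist_eq_norm]; linarith⟩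
  have hk : ∀ k : ℕ, DependsOn ((eulerStep c B h)^[k] g) (B : Set (Site d)) ∧
      N (delta ((eulerStep c B h)^[k] g))
        ≤ ENNReal.ofReal (Real.exp (k * h * (b - ε))) * N (delta g) := by
    intro k
    induction k with
    | zero => simpa using hgB
    | succ k ih =>
      rw [Function.iterate_succ_apply']
      obtain ⟨h1, h2⟩ := ih
      refine ⟨dependsOn_eulerStep h1, ?_⟩
      set a := delta ((eulerStep c B h)^[k] g)
      have h3 := hmono _ _ (delta_eulerStep_le hpos hε h.coe_nonneg hm2 hm1 h1)
      calc _ ≤ ENNReal.ofReal (1 - h * ε) * N a + ENNReal.ofReal h * N (influence c a) := by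
            refine h3.trans ((hadd _ _).trans_eq ?_)
            rw [hmul, hmul]
        _ ≤ ENNReal.ofReal (1 - h * ε) * N a + ENNReal.ofReal h * (ENNReal.ofReal b * N a) := by
            gcongr
            exact hT a (tsum_delta_ne_top ⟨B, h1⟩)
        _ = ENNReal.ofReal (1 - h * ε + h * b) * N a := by
            rw [ENNReal.ofReal_add (sub_nonneg.2 hm2) (by positivity), ENNReal.ofReal_mul h.coe_nonneg]
            ring
        _ ≤ ENNReal.ofReal (Real.exp (h * (b - ε)))
              * (ENNReal.ofReal (Real.exp (k * h * (b - ε))) * N (delta g)) := by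
            gcongr
            have := Real.add_one_le_exp (h * (b - ε))
            linarith
        _ = _ := by
            rw [← mul_assoc, ← ENNReal.ofReal_mul (Real.exp_pos _).le, ← Real.exp_add]
            congr 3
            push_cast; ring
  have := (hk m).2
  rwa [hmh] at this

end MarkovSemigroup

/-! ### Gaussian concentration under the evolution -/

theorem integrable_continuousMap (μ : ProbabilityMeasure (Config d)) (f : C(Config d, ℝ)) :
    Integrable f (μ : Measure (Config d)) :=
  f.continuous.integrable_of_hasCompactSupport (HasCompactSupport.of_compactSpace _)

/-- The exponential of a continuous function. -/
noncomputable def expMap (f : C(Config d, ℝ)) : C(Config d, ℝ) :=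
  ⟨fun σ => Real.exp (f σ), Real.continuous_exp.comp f.continuous⟩

theorem integral_exp_sub (μ : Measure (Config d)) (f : C(Config d, ℝ)) (r : ℝ) :
    ∫ σ, Real.exp (f σ - r) ∂μ = Real.exp (-r) * ∫ σ, expMap f σ ∂μ := by
  rw [← integral_const_mul]
  refine integral_congr_ae (Eventually.of_forall fun σ => ?_)
  simp only [expMap, ContinuousMap.coe_mk]
  rw [← Real.exp_add]
  congr 1; ring

/-- Removes the centering, leaving the integral of a fixed continuous function, on which the
semigroup acts. -/
theorem integral_exp_sub_le_iff (μ : Measure (Config d)) (f : C(Config d, ℝ)) (r s : ℝ) :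
    ∫ σ, Real.exp (f σ - r) ∂μ ≤ Real.exp s ↔ ∫ σ, expMap f σ ∂μ ≤ Real.exp (r + s) := by
  rw [integral_exp_sub, Real.exp_neg, inv_mul_le_iff₀ (Real.exp_pos r), Real.exp_add]

theorem eq_of_forall_integral_eq {μ ν : ProbabilityMeasure (Config d)}
    (h : ∀ f : C(Config d, ℝ), ∫ σ, f σ ∂(μ : Measure (Config d))
      = ∫ σ, f σ ∂(ν : Measure (Config d))) : μ = ν :=
  Subtype.ext (ext_of_forall_integral_eq_of_IsFiniteMeasure (μ := (μ : Measure (Config d)))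
    (ν := (ν : Measure (Config d))) fun f => h f.toContinuousMap)

namespace MarkovSemigroup

variable {S : MarkovSemigroup d} {c : Site d → C(Config d, ℝ)}

theorem integral_evolve_diracProba (t : ℝ≥0) (σ : Config d) (f : C(Config d, ℝ)) :
    ∫ ξ, f ξ ∂(S.evolve t (diracProba σ) : Measure (Config d)) = S.op t f σ := by
  rw [S.integral_evolve]
  exact integral_dirac (S.op t f) σ

theorem DiracGCB.op_expMap_le {t : ℝ≥0} {D : ℝ} (hD : S.DiracGCB t D) {f : C(Config d, ℝ)}
    (hf : deltaNormSq f ≠ ⊤) (σ : Config d) :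
    S.op t (expMap f) σ ≤ Real.exp (S.op t f σ + D * (deltaNormSq f).toReal) := by
  have h := (hD σ).2 f hf
  rwa [integral_exp_sub_le_iff, integral_evolve_diracProba, integral_evolve_diracProba] at h

theorem DiracGCB.integral_exp_evolve_le {t : ℝ≥0} {D : ℝ} (hD : S.DiracGCB t D)
    {μ : ProbabilityMeasure (Config d)} {C : ℝ} (hμ : GCB μ C) {f : C(Config d, ℝ)}
    (hf : deltaNormSq f ≠ ⊤) (hSf : deltaNormSq (S.op t f) ≠ ⊤) :
    ∫ σ, Real.exp (f σ - ∫ ξ, f ξ ∂(S.evolve t μ : Measure (Config d)))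
        ∂(S.evolve t μ : Measure (Config d))
      ≤ Real.exp (D * (deltaNormSq f).toReal + C * (deltaNormSq (S.op t f)).toReal) := by
  rw [integral_exp_sub_le_iff, S.integral_evolve, S.integral_evolve]
  have h1 := (integral_exp_sub_le_iff _ _ _ _).1 (hμ.2 (S.op t f) hSf)
  calc _ ≤ ∫ σ, Real.exp (D * (deltaNormSq f).toReal) * expMap (S.op t f) σ
          ∂(μ : Measure (Config d)) := by
        refine integral_mono (integrable_continuousMap μ _)
          ((integrable_continuousMap μ _).const_mul _) fun σ => ?_
        refine (hD.op_expMap_le hf σ).trans (le_of_eq ?_)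
        rw [add_comm, Real.exp_add]; rfl
    _ ≤ Real.exp (D * (deltaNormSq f).toReal)
          * Real.exp (∫ ξ, S.op t f ξ ∂(μ : Measure (Config d))
            + C * (deltaNormSq (S.op t f)).toReal) := by
        rw [integral_const_mul]
        exact mul_le_mul_of_nonneg_left h1 (Real.exp_pos _).le
    _ = _ := by rw [← Real.exp_add]; congr 1; ring

theorem DiracGCB.gcb_evolve {t : ℝ≥0} {D : ℝ} (hD : S.DiracGCB t D)
    {μ : ProbabilityMeasure (Config d)} {C : ℝ} (hμ : GCB μ C) {K : ℝ≥0}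
    (hK : S.DeltaBound t K) : GCB (S.evolve t μ) (D + K * C) := by
  refine ⟨add_pos_of_pos_of_nonneg (hD 1).1 (mul_nonneg K.2 hμ.1.le), fun f hf => ?_⟩
  have h1 := hK f hf
  have h2 : (K : ℝ≥0∞) * deltaNormSq f ≠ ⊤ := ENNReal.mul_ne_top ENNReal.coe_ne_top hf
  refine (hD.integral_exp_evolve_le hμ hf (ne_top_of_le_ne_top h2 h1)).trans
    (Real.exp_le_exp.2 ?_)
  have h3 := ENNReal.toReal_mono h2 h1
  rw [ENNReal.toReal_mul, ENNReal.coe_toReal] at h3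
  nlinarith [mul_le_mul_of_nonneg_left h3 hμ.1.le]

/-! ### Bounds on the oscillations of `S(t) f` -/

/-- Freezing does not increase oscillations, `S.op t` is continuous and sublevel sets of
`deltaNormSq` are closed. -/
theorem deltaBound_of_isLocal {t : ℝ≥0} {K : ℝ≥0}
    (h : ∀ g : C(Config d, ℝ), IsLocal g → deltaNormSq (S.op t g) ≤ K * deltaNormSq g) :
    S.DeltaBound t K := by
  intro f _
  refine (isClosed_deltaNormSq_le _).mem_of_tendsto
    (((S.continuous_op t).tendsto f).comp (tendsto_comp_freeze f))
    (Eventually.of_forall fun B => ?_)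
  refine (h _ ⟨B, dependsOn_comp_freeze f B⟩).trans ?_
  unfold deltaNormSq
  gcongr with i
  exact delta_comp_freeze_le f B i

theorem IsGeneratedBy.tsum_delta_op_le (hS : S.IsGeneratedBy c) (hc : ConditionA c) {ε b : ℝ}
    (hε : ∀ i σ, ε ≤ c i σ + c i (flip i σ)) (hb : 0 ≤ b) (hM : rowM c ≤ ENNReal.ofReal b)
    {g : C(Config d, ℝ)} (hg : IsLocal g) (t : ℝ≥0) :
    ∑' i, delta (S.op t g) i ≤ ENNReal.ofReal (Real.exp (t * (b - ε))) * ∑' i, delta g i :=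
  hS.norm_delta_op_le hc hε hb (fun a => ∑' i, a i) isClosed_tsum_delta_le
    (fun _ _ h => ENNReal.tsum_le_tsum h) (fun _ _ => ENNReal.tsum_add.le)
    (fun _ _ => ENNReal.tsum_mul_left)
    (fun a _ => (tsum_influence_le c a).trans (by gcongr)) hg t

theorem IsGeneratedBy.deltaBound (hS : S.IsGeneratedBy c) (hc : ConditionA c) {ε b : ℝ}
    (hε : ∀ i σ, ε ≤ c i σ + c i (flip i σ)) (hb : 0 ≤ b)
    (hT : ∀ a : Site d → ℝ≥0∞, ∑' i, a i ≠ ⊤ →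
      ∑' i, influence c a i ^ 2 ≤ ENNReal.ofReal b ^ 2 * ∑' i, a i ^ 2) (t : ℝ≥0) :
    S.DeltaBound t (Real.exp (2 * (t * (b - ε)))).toNNReal := by
  have hs : ∀ x : ℝ≥0∞, (x ^ 2) ^ (1 / 2 : ℝ) = x := fun x => by
    rw [← ENNReal.rpow_two, ← ENNReal.rpow_mul]; norm_num
  have hs' : ∀ x : ℝ≥0∞, (x ^ (1 / 2 : ℝ)) ^ 2 = x := fun x => by
    rw [← ENNReal.rpow_two, ← ENNReal.rpow_mul]; norm_num
  have hle : ∀ x y : ℝ≥0∞, x ^ (1 / 2 : ℝ) ≤ y ↔ x ≤ y ^ 2 := fun x y => by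
    constructor <;> intro h
    · rw [← hs' x]; gcongr
    · rw [← hs y]; gcongr
  refine deltaBound_of_isLocal fun g hg => ?_
  have h := hS.norm_delta_op_le hc hε hb (fun a => (∑' i, a i ^ 2) ^ (1 / 2 : ℝ))
    (fun r => by simp only [hle]; exact isClosed_deltaNormSq_le (r ^ 2))
    (fun a a' h => by gcongr with i; exact h i)
    tsum_add_sq_rpow_le
    (fun r a => by
      simp only [mul_pow, ENNReal.tsum_mul_left]
      rw [ENNReal.mul_rpow_of_nonneg _ _ (by norm_num), hs])
    (fun a ha => by
      rw [hle, mul_pow, hs']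
      exact hT a ha) hg t
  rw [hle, mul_pow, hs', ← ENNReal.ofReal_pow (Real.exp_pos _).le, ← Real.exp_nat_mul] at h
  exact h

/-- Row sums of `Γ` alone give no `ℓ²` bound, but they control `ℓ¹`, and a summable sequence is
square summable. Taking `ε = 0` suffices for finiteness. -/
theorem IsGeneratedBy.deltaNormSq_op_ne_top (hS : S.IsGeneratedBy c) (hc : ConditionA c)
    {g : C(Config d, ℝ)} (hg : IsLocal g) (t : ℝ≥0) : deltaNormSq (S.op t g) ≠ ⊤ := by
  obtain ⟨m, hm, hm'⟩ := hc.pos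
  refine tsum_sq_ne_top (ne_top_of_le_ne_top ?_ (hS.tsum_delta_op_le hc (ε := 0)
    (b := (rowM c).toReal) (fun i σ => add_nonneg (hm.le.trans (hm' _ _)) (hm.le.trans (hm' _ _)))
    ENNReal.toReal_nonneg (ENNReal.ofReal_toReal (rowM_lt_top hc).ne).ge hg t))
  exact ENNReal.mul_ne_top ENNReal.ofReal_ne_top (tsum_delta_ne_top hg)

theorem IsGeneratedBy.exists_deltaBound (hS : S.IsGeneratedBy c) (hc : ConditionA c)
    (hB : GamBoundedL2 c) (t : ℝ≥0) : ∃ K : ℝ≥0, S.DeltaBound t K := by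
  obtain ⟨m, hm, hm'⟩ := hc.pos
  obtain ⟨B, hB⟩ := hB
  refine ⟨_, hS.deltaBound hc (ε := 0) (b := √B)
    (fun i σ => add_nonneg (hm.le.trans (hm' _ _)) (hm.le.trans (hm' _ _)))
    (Real.sqrt_nonneg _) (fun a ha => ?_) t⟩
  rw [← ENNReal.ofReal_pow (Real.sqrt_nonneg _), Real.sq_sqrt B.coe_nonneg]
  exact (tsum_influence_sq_le_of_bounded hc hB ha).trans_eq (by simp)

/-! ### The uniformly ergodic regime -/

variable (S) in
/-- The functions `S(t) f` become constant, uniformly on `Ω`. -/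
def Mixing : Prop :=
  ∀ (f : C(Config d, ℝ)) (η : ℝ), 0 < η → ∀ᶠ t : ℝ≥0 in atTop, ∀ σ ξ : Config d,
    S.op t f σ - S.op t f ξ ≤ η

/-- For a local approximant the total oscillation is at most `∑ δ_i`, which decays like `exp (-(ε -
b) t)`; contractivity controls the approximation error. -/
theorem IsGeneratedBy.mixing (hS : S.IsGeneratedBy c) (hc : ConditionA c) {ε b : ℝ}
    (hε : ∀ i σ, ε ≤ c i σ + c i (flip i σ)) (hb : 0 ≤ b) (hM : rowM c ≤ ENNReal.ofReal b)
    (hbε : b < ε) : S.Mixing := by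
  intro f η hη
  obtain ⟨B, hB⟩ := ((tendsto_comp_freeze f).eventually
    (Metric.ball_mem_nhds f (show 0 < η / 3 by positivity))).exists
  set g := f.comp (freeze B)
  have hg : IsLocal g := ⟨B, dependsOn_comp_freeze f B⟩
  set R := (∑' i, delta g i).toReal
  have hlim : Tendsto (fun t : ℝ≥0 => Real.exp (t * (b - ε)) * R) atTop (𝓝 0) := by
    have h1 : Tendsto (fun t : ℝ≥0 => (t : ℝ) * (b - ε)) atTop atBot :=
      (NNReal.tendsto_coe_atTop.2 tendsto_id).atTop_mul_const_of_neg (sub_neg.2 hbε)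
    simpa using (Real.tendsto_exp_atBot.comp h1).mul_const R
  filter_upwards [hlim.eventually (ge_mem_nhds (show 0 < η / 3 by positivity))] with t ht σ ξ
  have h1 : S.op t g σ - S.op t g ξ ≤ η / 3 := by
    refine (le_abs_self _).trans (le_trans ?_ ht)
    refine (ENNReal.ofReal_le_ofReal_iff (by positivity)).1 ?_
    refine (ofReal_abs_sub_le_tsum_delta _ σ ξ).trans
      ((hS.tsum_delta_op_le hc hε hb hM hg t).trans (le_of_eq ?_))
    rw [ENNReal.ofReal_mul (Real.exp_pos _).le, ENNReal.ofReal_toReal (tsum_delta_ne_top hg)]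
  have h2 : ∀ ζ, |S.op t f ζ - S.op t g ζ| ≤ η / 3 := fun ζ => by
    have h3 := ((S.op t (f - g)).norm_coe_le_norm ζ).trans (S.norm_op_le t (f - g))
    rw [map_sub, ← dist_eq_norm, dist_comm] at h3
    exact h3.trans (le_of_lt hB)
  have h4 := abs_le.1 (h2 σ)
  have h5 := abs_le.1 (h2 ξ)
  linarith [h4.2, h5.1]

/-- Stationarity replaces `f` by the nearly constant `S(t) f`, so both integrals are close to its
value at one point. -/
theorem Mixing.stationary_unique (hS : S.Mixing) {ν ν' : ProbabilityMeasure (Config d)}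
    (hν : S.IsStationary ν) (hν' : S.IsStationary ν') : ν = ν' := by
  have key : ∀ {ν ν' : ProbabilityMeasure (Config d)}, S.IsStationary ν → S.IsStationary ν' →
      ∀ f : C(Config d, ℝ), ∫ σ, f σ ∂(ν : Measure (Config d))
        ≤ ∫ σ, f σ ∂(ν' : Measure (Config d)) := by
    intro ν ν' hν hν' f
    refine le_of_forall_pos_le_add fun η hη => ?_
    obtain ⟨t, ht⟩ := (hS f (η / 2) (half_pos hη)).exists
    have h1 : ∫ σ, f σ ∂(ν : Measure (Config d)) ≤ S.op t f 1 + η / 2 := by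
      rw [← hν t, S.integral_evolve]
      have := integral_mono (integrable_continuousMap ν (S.op t f))
        (integrable_const (S.op t f 1 + η / 2)) fun σ => by linarith [ht σ 1]
      simpa using this
    have h2 : S.op t f 1 - η / 2 ≤ ∫ σ, f σ ∂(ν' : Measure (Config d)) := by
      rw [← hν' t, S.integral_evolve]
      have := integral_mono (integrable_const (S.op t f 1 - η / 2))
        (integrable_continuousMap ν' (S.op t f)) fun σ => by linarith [ht 1 σ]
      simpa using this
    linarith
  exact eq_of_forall_integral_eq fun f => le_antisymm (key hν hν' f) (key hν' hν f)

/-- A measure which the evolution started from a point approaches along an ultrafilter of times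
tending to infinity. -/
theorem exists_tendsto_op (S : MarkovSemigroup d) :
    ∃ (u : Ultrafilter ℝ≥0) (ν : ProbabilityMeasure (Config d)), (u : Filter ℝ≥0) ≤ atTop ∧
      ∀ f : C(Config d, ℝ),
        Tendsto (fun t => S.op t f 1) u (𝓝 (∫ σ, f σ ∂(ν : Measure (Config d)))) := by
  set u := Ultrafilter.of (atTop : Filter ℝ≥0)
  obtain ⟨ν, -, hν⟩ := isCompact_univ.ultrafilter_le_nhds
    (u.map fun t => S.evolve t (diracProba 1)) (by simp)
  refine ⟨u, ν, Ultrafilter.of_le _, fun f => ?_⟩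
  have h := ProbabilityMeasure.tendsto_iff_forall_integral_tendsto.1
    (show Tendsto (fun t => S.evolve t (diracProba 1)) u (𝓝 ν) from hν)
    (BoundedContinuousFunction.mkOfCompact f)
  simpa [integral_evolve_diracProba] using h

/-- The limit point is stationary: `S(t) S(s) f = S(s) S(t) f`, and `S(s)` hardly moves the nearly
constant `S(t) f`. The uncentered concentration bound passes to the limit, with each `D t` replaced
by the supremum. -/
theorem Mixing.exists_stationary (hS : S.Mixing) :
    ∃ ν : ProbabilityMeasure (Config d), S.IsStationary ν ∧
      ∀ D : ℝ≥0 → ℝ, (∀ t : ℝ≥0, S.DiracGCB t (D t)) → BddAbove (Set.range D) →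
        GCB ν (⨆ t : ℝ≥0, D t) := by
  obtain ⟨u, ν, hu, hν⟩ := S.exists_tendsto_op
  refine ⟨ν, fun s => eq_of_forall_integral_eq fun f => ?_, fun D hD hbdd => ?_⟩
  · rw [S.integral_evolve]
    refine tendsto_nhds_unique (hν (S.op s f)) ?_
    have h1 : Tendsto (fun t => S.op t (S.op s f) 1 - S.op t f 1) u (𝓝 0) := by
      refine Metric.tendsto_nhds.2 fun η hη => hu ?_
      filter_upwards [hS f (η / 2) (half_pos hη)] with t ht
      have h2 : S.op t (S.op s f) = S.op s (S.op t f) := by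
        rw [← LinearMap.comp_apply, ← LinearMap.comp_apply, ← S.op_add, ← S.op_add, add_comm]
      have h3 := S.op_mono s (f := S.op t f) (g := ContinuousMap.const _ (S.op t f 1 + η / 2))
        fun σ => show S.op t f σ ≤ S.op t f 1 + η / 2 by linarith [ht σ 1]
      have h4 := S.op_mono s (f := ContinuousMap.const _ (S.op t f 1 - η / 2)) (g := S.op t f)
        fun σ => show S.op t f 1 - η / 2 ≤ S.op t f σ by linarith [ht 1 σ]
      rw [op_const] at h3 h4
      have h5 : S.op s (S.op t f) 1 ≤ S.op t f 1 + η / 2 := h3 1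
      have h6 : S.op t f 1 - η / 2 ≤ S.op s (S.op t f) 1 := h4 1
      rw [Real.dist_eq, sub_zero, h2, abs_lt]
      constructor <;> linarith
    simpa using h1.add (hν f)
  · refine ⟨((hD 0) 1).1.trans_le (le_ciSup hbdd 0), fun f hf => ?_⟩
    rw [integral_exp_sub_le_iff]
    refine le_of_tendsto_of_tendsto' (hν (expMap f))
      ((Real.continuous_exp.tendsto _).comp ((hν f).add_const _)) fun t => ?_
    refine ((hD t).op_expMap_le hf 1).trans (Real.exp_le_exp.2 ?_)
    have := mul_le_mul_of_nonneg_right (le_ciSup hbdd t) (deltaNormSq f).toReal_nonneg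
    linarith

end MarkovSemigroup

theorem rateEps_toReal_le {c : Site d → C(Config d, ℝ)} (hc : ConditionA c) (i : Site d)
    (σ : Config d) : (rateEps c).toReal ≤ c i σ + c i (flip i σ) := by
  obtain ⟨m, hm, hm'⟩ := hc.pos
  exact ENNReal.toReal_le_of_le_ofReal
    (add_nonneg (hm.le.trans (hm' _ _)) (hm.le.trans (hm' _ _)))
    (iInf₂_le (f := fun i σ => ENNReal.ofReal (c i σ + c i (flip i σ))) i σ)

theorem rateEps_ne_top (c : Site d → C(Config d, ℝ)) : rateEps c ≠ ⊤ :=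
  ne_top_of_le_ne_top ENNReal.ofReal_ne_top
    (iInf₂_le (f := fun i σ => ENNReal.ofReal (c i σ + c i (flip i σ))) 0 1)

end SpinFlip

theorem mainTheorem5 {d : ℕ} (c : SpinFlip.Site d → C(SpinFlip.Config d, ℝ))
    (hc : SpinFlip.ConditionA c)
    (S : SpinFlip.MarkovSemigroup d) (hS : S.IsGeneratedBy c) :
    -- the general bound, and its first consequence
    (∀ (t : ℝ≥0) (D : ℝ), S.DiracGCB t D →
      ∀ (μ : ProbabilityMeasure (SpinFlip.Config d)) (C : ℝ), SpinFlip.GCB μ C →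
        (∀ f : C(SpinFlip.Config d, ℝ), SpinFlip.IsLocal f →
          SpinFlip.deltaNormSq f ≠ ⊤ ∧ SpinFlip.deltaNormSq (S.op t f) ≠ ⊤ ∧
          Real.log (∫ σ, Real.exp (f σ - ∫ ξ, f ξ ∂(S.evolve t μ : Measure (SpinFlip.Config d)))
              ∂(S.evolve t μ : Measure (SpinFlip.Config d)))
            ≤ D * (SpinFlip.deltaNormSq f).toReal
              + C * (SpinFlip.deltaNormSq (S.op t f)).toReal) ∧
        (∀ K : ℝ≥0, S.DeltaBound t K → SpinFlip.GCB (S.evolve t μ) (D + K * C))) ∧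
    -- finiteness of the constants `K(t)`
    (SpinFlip.GamBoundedL2 c → ∀ t : ℝ≥0, ∃ K : ℝ≥0, S.DeltaBound t K) ∧
    -- the uniformly ergodic regime
    (SpinFlip.rowM c < SpinFlip.rateEps c → SpinFlip.colM c < SpinFlip.rateEps c →
      (∃ α : ℝ, 0 < α ∧ ∀ (t : ℝ≥0) (D : ℝ), S.DiracGCB t D →
        ∀ (μ : ProbabilityMeasure (SpinFlip.Config d)) (C : ℝ), SpinFlip.GCB μ C →
          SpinFlip.GCB (S.evolve t μ) (D + C * Real.exp (-α * t))) ∧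
      ∃ ν : ProbabilityMeasure (SpinFlip.Config d),
        S.IsStationary ν ∧
        (∀ ν' : ProbabilityMeasure (SpinFlip.Config d), S.IsStationary ν' → ν' = ν) ∧
        ∀ D : ℝ≥0 → ℝ, (∀ t : ℝ≥0, S.DiracGCB t (D t)) → BddAbove (Set.range D) →
          SpinFlip.GCB ν (⨆ t : ℝ≥0, D t)) := by
  have hlocal : ∀ f : C(SpinFlip.Config d, ℝ), SpinFlip.IsLocal f →
      SpinFlip.deltaNormSq f ≠ ⊤ := fun f hf =>
    SpinFlip.tsum_sq_ne_top (SpinFlip.tsum_delta_ne_top hf)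
  refine ⟨fun t D hD μ C hμ => ⟨fun f hf => ?_, fun K hK => hD.gcb_evolve hμ hK⟩,
    fun hB t => hS.exists_deltaBound hc hB t, fun hrow hcol => ?_⟩
  · have hSf := hS.deltaNormSq_op_ne_top hc hf t
    refine ⟨hlocal f hf, hSf, ?_⟩
    rw [← Real.log_exp (_ + _)]
    refine Real.log_le_log ?_ (hD.integral_exp_evolve_le hμ (hlocal f hf) hSf)
    rw [SpinFlip.integral_exp_sub]
    exact mul_pos (Real.exp_pos _)
      (integral_exp_pos (SpinFlip.integrable_continuousMap _ (SpinFlip.expMap f)))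
  · set M := max (SpinFlip.rowM c) (SpinFlip.colM c) with hM
    have hMε : M < SpinFlip.rateEps c := max_lt hrow hcol
    have hMtop : M ≠ ⊤ := hMε.ne_top
    have hbε : M.toReal < (SpinFlip.rateEps c).toReal :=
      (ENNReal.toReal_lt_toReal hMtop (SpinFlip.rateEps_ne_top c)).2 hMε
    have hMb : ENNReal.ofReal M.toReal = M := ENNReal.ofReal_toReal hMtop
    have hε := SpinFlip.rateEps_toReal_le hc
    -- Oscillations decay in `ℓ²` at rate `ε - max(M, M*)`; squaring the norm doubles the rate.
    refine ⟨⟨2 * ((SpinFlip.rateEps c).toReal - M.toReal), by linarith,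
      fun t D hD μ C hμ => ?_⟩, ?_⟩
    · have hK := hS.deltaBound hc hε ENNReal.toReal_nonneg (fun a _ => by
        rw [hMb]
        exact SpinFlip.tsum_influence_sq_le_of_schur c (le_max_left _ _) (le_max_right _ _) a) t
      have h := hD.gcb_evolve hμ hK
      rw [Real.coe_toNNReal _ (Real.exp_pos _).le] at h
      convert h using 2
      rw [mul_comm]
      congr 2
      ring
    · have hmix := hS.mixing hc hε ENNReal.toReal_nonneg ((le_max_left _ _).trans hMb.ge) hbε
      obtain ⟨ν, hν, hgcb⟩ := hmix.exists_stationary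
      exact ⟨ν, hν, fun ν' hν' => hmix.stationary_unique hν' hν, hgcb⟩
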